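/- Let $\mathcal P_2(\mathbb R^d)$ be the set of Borel probability measures $\mu$ on $\mathbb R^d$ with $\mathcal M_2(\mu):=\int|x|^2\,\mu(dx)<\infty$; for $1\le r\le 2$ let $d_r(\mu,\beta)=\inf_\gamma\big(\int|x-y|^r\,\gamma(dx,dy)\big)^{1/r}$ be the Wasserstein distance, the infimum being over all couplings $\gamma$ of $\mu$ and $\beta$. Let $\Omega=(0,1)$ with Lebesgue measure $\mathcal L^1$ and $E=L^2(\Omega;\mathbb R^d)$. The lift of $\phi:\mathbb R^d\times\mathcal P_2(\mathbb R^d)\to\mathbb R$ is $\tilde\phi:\mathbb R^d\times E\to\mathbb R$, $\tilde\phi(x,X)=\phi(x,X_\#\mathcal L^1)$. We say that $\phi$ is Lipschitz for $|\cdot|\times d_r$ with constant $C$ if $|\phi(x,\mu)-\phi(y,\beta)|\le C(|x-y|+d_r(\mu,\beta))$ for all $x,y\in\mathbb R^d$ and $\mu,\beta\in\mathcal P_2(\mathbb R^d)$. A function $f:(\mathbb R^d)^m\times\mathcal P_2(\mathbb R^d)\to\mathbb R$ is of class $C^0$ if it is jointly continuous, $\mathcal P_2(\mathbb R^d)$ carrying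 the distance $d_2$. It is of class $C^{n+1}$ if it is jointly continuous; its lift $(v,X)\mapsto f(v,X_\#\mathcal L^1)$ on $(\mathbb R^d)^m\times E$ is continuously Fréchet differentiable; its gradients $D_{v_1}f,\dots,D_{v_m}f$ exist and have components of class $C^n$; and its Lions derivative has a version $(v,\mu,y)\mapsto\partial_\mu f(v,\mu)(y)\in\mathbb R^d$, defined for every $y\in\mathbb R^d$ (that is, the gradient in $X$ of the lift at $(v,X)$ is $\omega\mapsto\partial_\mu f(v,X_\#\mathcal L^1)(X(\omega))$), whose components are of class $C^n$ as functions on $(\mathbb R^d)^{m+1}\times\mathcal P_2(\mathbb R^d)$. Finally $C^\infty(\mathbb R^d\times\mathcal P_2(\mathbb R^d))$ is the set of functions that are of class $C^n$ for all $n$ (with $m=1$), and $C^{1,1}(\mathbb R^d\times E)$ is the set of Fréchet differentiable real functions with globally Lipschitz derivative. Let $\eta(x)=c\,e^{1/(|x|^2-1)}$ for $|x|<1$ and $\eta(x)=0$ for $|x|\ge1$, with $c$ such that $\int\eta=1$, and let $\eta_\varepsilon(x)=\varepsilon^{-d}\eta(x/\varepsilon)$. **Theorem.** Let $r\in[1,2)$,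 and let $\phi:\mathbb R^d\times\mathcal P_2(\mathbb R^d)\to\mathbb R$ be Lipschitz for $|\cdot|\times d_r$. Then there is a sequence $(\phi_k)_{k\ge1}$ in $C^\infty(\mathbb R^d\times\mathcal P_2(\mathbb R^d))$ with lifts $\tilde\phi_k$ such that: (i) there is a constant $C$ such that every $\phi_k$ is Lipschitz for $|\cdot|\times d_r$ with constant $C$; (ii) for every $R>0$, $\ \sup\{|\phi_k(x,\mu)-\phi(x,\mu)|:\ |x|<R,\ \mathcal M_2(\mu)\le R\}\to0$ as $k\to\infty$; (iii) $\tilde\phi_k\in C^{1,1}(\mathbb R^d\times E)$ for each $k$; (iv) if $\tilde\phi$ is convex on $\mathbb R^d\times E$, then $\tilde\phi_k$ is convex on $\mathbb R^d\times E$ for each $k$. Moreover, these properties hold for the sequence $$\phi_k(x,\mu)=\int_{(\mathbb R^d)^k}\int_{(\mathbb R^d)^{k+1}}\phi\Big(x-y_0,\frac1k\sum_{i=1}^k\delta_{x_i-y_i}\Big)\,\eta_{1/k}(y_0)\cdots\eta_{1/k}(y_k)\,dy_0\cdots dy_k\;\mu^{\otimes k}(dx_1,\dots,dx_k).$$ 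-/

import Mathlib

open MeasureTheory Filter Topology Set
open scoped ENNReal NNReal

namespace WassersteinApprox

noncomputable section

/-- The Euclidean space `ℝ^d`. -/
abbrev Rd (d : ℕ) : Type := EuclideanSpace ℝ (Fin d)

/-- The second moment `∫ |x|² μ(dx)`, as an extended nonnegative real number. -/
def secondMoment {d : ℕ} (μ : Measure (Rd d)) : ℝ≥0∞ := ∫⁻ x, ‖x‖ₑ ^ (2 : ℝ) ∂μ

/-- The set of Borel probability measures on `ℝ^d` with finite second moment. -/
def P2 (d : ℕ) : Type := {μ : Measure (Rd d) // IsProbabilityMeasure μ ∧ secondMoment μ < ∞}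

/-- `γ` is a coupling of `μ` and `ν`: a measure on the product with marginals `μ` and `ν`. -/
def IsCoupling {d : ℕ} (μ ν : Measure (Rd d)) (γ : Measure (Rd d × Rd d)) : Prop :=
  γ.map Prod.fst = μ ∧ γ.map Prod.snd = ν

/-- The `r`-Wasserstein distance `inf_γ (∫ |x - y|^r γ(dx,dy))^{1/r}`. For `μ, ν ∈ P2` and
`1 ≤ r ≤ 2` the infimum is finite, so that `toReal` loses nothing. -/
def wassersteinDist {d : ℕ} (r : ℝ) (μ ν : P2 d) : ℝ :=
  (⨅ (γ : Measure (Rd d × Rd d)) (_ : IsCoupling μ.1 ν.1 γ),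
    (∫⁻ p, ‖p.1 - p.2‖ₑ ^ r ∂γ) ^ (1 / r)).toReal

/-- Lebesgue measure on `Ω = (0,1)`. -/
def unitMeasure : Measure ℝ := volume.restrict (Ioo (0 : ℝ) 1)

instance : IsProbabilityMeasure unitMeasure := ⟨by simp [unitMeasure]⟩

/-- The Hilbert space `E = L²((0,1); ℝ^d)`. -/
abbrev E (d : ℕ) : Type := Lp (Rd d) 2 unitMeasure

/-- The law `X_# 𝓛¹` of `X ∈ E`, an element of `P2`. -/
def law {d : ℕ} (X : E d) : P2 d :=
  ⟨unitMeasure.map X, by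
    have hX : AEMeasurable X unitMeasure := (Lp.aestronglyMeasurable X).aemeasurable
    refine ⟨Measure.isProbabilityMeasure_map hX, ?_⟩
    unfold secondMoment
    rw [lintegral_map' (by fun_prop) hX]
    have h := lintegral_rpow_enorm_lt_top_of_eLpNorm_lt_top (p := 2) (by norm_num) (by norm_num)
      (Lp.memLp X).2
    simpa using h⟩

/-- The lift `(x, X) ↦ φ(x, X_# 𝓛¹)`, for a first variable in any type. -/
def lift {V : Type} {d : ℕ} (φ : V → P2 d → ℝ) : V × E d → ℝ := fun p => φ p.1 (law p.2)

/-- Lipschitz continuity with constant `C` with respect to the `|·| × d_r` distance. -/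
def IsLipschitzWith {d : ℕ} (r C : ℝ) (φ : Rd d → P2 d → ℝ) : Prop :=
  ∀ (x y : Rd d) (μ β : P2 d), |φ x μ - φ y β| ≤ C * (‖x - y‖ + wassersteinDist r μ β)

/-- `F ∈ C^{1,1}`: Fréchet differentiable everywhere with (globally) Lipschitz derivative. -/
def IsC11 {H : Type} [NormedAddCommGroup H] [NormedSpace ℝ H] (F : H → ℝ) : Prop :=
  Differentiable ℝ F ∧ ∃ K : ℝ≥0, LipschitzWith K (fderiv ℝ F)

/-! ### Smoothness on `ℝ^d × P2` -/

/-- Joint continuity of `f : (ℝ^d)^m × P2 → ℝ`, where `P2` carries the distance `d_2`. -/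
def JointlyContinuous {d m : ℕ} (f : (Fin m → Rd d) → P2 d → ℝ) : Prop :=
  ∀ (v : Fin m → Rd d) (μ : P2 d), ∀ ε > 0, ∃ δ > 0, ∀ (w : Fin m → Rd d) (ν : P2 d),
    dist w v < δ → wassersteinDist 2 ν μ < δ → |f w ν - f v μ| < ε

/-- `g : ℝ^d → ℝ^d` is (a version of) the Lions derivative of `u : P2 → ℝ` at `μ`: at every `X ∈ E`
with law `μ`, the lift of `u` is Fréchet differentiable, with gradient `g ∘ X`. -/
def HasLDerivAt {d : ℕ} (u : P2 d → ℝ) (g : Rd d → Rd d) (μ : P2 d) : Prop :=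
  ∀ X : E d, law X = μ → ∃ ξ : E d,
    HasGradientAt (fun Y : E d => u (law Y)) ξ X ∧ (ξ : ℝ → Rd d) =ᵐ[unitMeasure] fun ω => g (X ω)

/-- `f : (ℝ^d)^m × P2 → ℝ` is of class `C^k`, by recursion on `k`. Class `C^0` is joint continuity.
Class `C^{k+1}` asks in addition that
* the lift be continuously Fréchet differentiable,
* the gradients `D_{v_i} f` exist and have components of class `C^k`,
* the Lions derivative `∂_μ f(v, μ)(y)` exist, with a version all of whose components, regarded as
  functions of `((v, y), μ) ∈ (ℝ^d)^{m+1} × P2`, are of class `C^k`.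

So all mixed derivatives up to order `k`, in `v`, in `μ` and in the auxiliary variables that are
created by Lions derivatives, exist and are jointly continuous. -/
def IsCk {d : ℕ} : ℕ → (m : ℕ) → ((Fin m → Rd d) → P2 d → ℝ) → Prop
  | 0, _, f => JointlyContinuous f
  | k + 1, m, f =>
      JointlyContinuous f ∧
      ContDiff ℝ 1 (lift f) ∧
      (∃ D : Fin m → (Fin m → Rd d) → P2 d → Rd d,
        (∀ i v μ, HasGradientAt (fun y : Rd d => f (Function.update v i y) μ) (D i v μ) (v i)) ∧
        ∀ i (j : Fin d), IsCk k m (fun v μ => D i v μ j)) ∧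
      (∃ g : (Fin m → Rd d) → P2 d → Rd d → Rd d,
        (∀ v μ, HasLDerivAt (f v) (g v μ) μ) ∧
        ∀ j : Fin d,
          IsCk k (m + 1) (fun w μ => g (fun i => w i.castSucc) μ (w (Fin.last m)) j))

/-- `φ ∈ C^∞(ℝ^d × P2)`. -/
def IsSmooth {d : ℕ} (φ : Rd d → P2 d → ℝ) : Prop :=
  ∀ k : ℕ, IsCk k 1 (fun v μ => φ (v 0) μ)

/-! ### Mollification and averaging over empirical measures -/

/-- The unnormalized bump `exp (1 / (|x|² - 1))` on the open unit ball, `0` outside. -/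
def bump {d : ℕ} (x : Rd d) : ℝ := if ‖x‖ < 1 then Real.exp (1 / (‖x‖ ^ 2 - 1)) else 0

/-- The standard mollifier `η_ε(x) = ε^{-d} η(x / ε)`, with `η` the bump of total mass one. -/
def mollifier {d : ℕ} (ε : ℝ) (x : Rd d) : ℝ :=
  (ε ^ d)⁻¹ * (bump (ε⁻¹ • x) / ∫ z : Rd d, bump z)

/-- The empirical measure `(1/N) ∑ δ_{x_i}`. -/
def empirical {d N : ℕ} [NeZero N] (x : Fin N → Rd d) : P2 d :=
  ⟨(N : ℝ≥0∞)⁻¹ • ∑ i, Measure.dirac (x i), by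
    have hN : (N : ℝ≥0∞) ≠ 0 := by exact_mod_cast NeZero.ne N
    constructor
    · constructor
      simp [ENNReal.inv_mul_cancel hN (ENNReal.natCast_ne_top N)]
    · simp only [secondMoment, lintegral_smul_measure, lintegral_finsetSum_measure,
        lintegral_dirac]
      refine ENNReal.mul_lt_top (ENNReal.inv_lt_top.2 (pos_iff_ne_zero.2 hN)) ?_
      refine ENNReal.sum_lt_top.2 fun i _ => ?_
      exact ENNReal.rpow_lt_top_of_nonneg (by norm_num) (by simp)⟩

/-- The mollification
`h_{N,ε}(x₀, x) = ∫ φ(x₀ - y₀, (1/N) ∑ δ_{x_i - y_i}) η_ε(y₀) ⋯ η_ε(y_N) dy₀ ⋯ dy_N`. -/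
def mollify {d : ℕ} (φ : Rd d → P2 d → ℝ) (N : ℕ) [NeZero N] (ε : ℝ)
    (x₀ : Rd d) (x : Fin N → Rd d) : ℝ :=
  ∫ y : Fin (N + 1) → Rd d,
    φ (x₀ - y 0) (empirical fun i => x i - y i.succ) * ∏ i, mollifier ε (y i)

/-- The average `𝔼[h_{N,ε}(x, X₁, …, X_N)]` over independent `X₁, …, X_N` of law `μ`. -/
def approx {d : ℕ} (φ : Rd d → P2 d → ℝ) (N : ℕ) [NeZero N] (ε : ℝ)
    (x : Rd d) (μ : P2 d) : ℝ :=
  ∫ X : Fin N → Rd d, mollify φ N ε x X ∂(Measure.pi fun _ => μ.1)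

end

end WassersteinApprox

/-! Evaluating `φ` at empirical measures gives a function `onPoints φ N` on the finite-dimensional
space `(ℝ^d)^{N+1}`. It is Lipschitz, so its convolution `mollifyAll` with a compactly supported
bump is smooth, with every derivative of positive order bounded (`boundedDerivs_convolution`). The
approximation is the mean of this function `G` over `N` independent samples of `μ`, and each
property of `φ_k` is read off from `G`.

Smoothness: the Lions derivative of `μ ↦ ∫ G dμ^{⊗N}` at `y` is the sum over `i` of the averages of
`∂_{x_i} G` with `y` inserted for `x_i`. This is again an average of a function with bounded
derivatives, with one more free variable, so the class of such averages is closed under all the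
derivatives in the definition and induction applies (`isCk_average`).

`C^{1,1}`: the lift is the functional `U ↦ ∫ G(U)` on `L²((0,1)^N)` composed with the continuous
linear map `X ↦ (X(ω₁), …, X(ω_N))`. Since `DG` is Lipschitz, the Taylor remainder is quadratic
pointwise, and integrating it gives a quadratic remainder in `L²` (`hasFDerivAt_integral_comp`).

Lipschitz bound: for a coupling `γ` of `μ` and `β`, drawing the two samples from `γ^{⊗N}` couples
the two empirical measures point by point, and Jensen's inequality for `t ↦ t^{1/r}` returns the
cost of `γ`. The constant of `φ` is preserved.

Convexity: an empirical measure is the law of a step function that depends linearly on the points,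
so convexity of the lift passes to `onPoints`, then to its mollification, then to the average,
because sampling is linear in `X`.

Convergence: mollifying costs at most `2Cε`. The rest is a law of large numbers, uniform over
bounded second moments. As `r < 2`, tails are uniformly small in `r`-cost, so all these measures are
discretized by one simple function; on its finite range the transport cost is controlled by the
deviation of frequencies, which is at most `1/√N` in mean by a variance bound. -/

namespace WassersteinApprox

noncomputable section

/-! ### Couplings and the Wasserstein distance -/

/-- The transport cost `∫ |x - y|^r γ(dx, dy)`. -/
def cost {d : ℕ} (r : ℝ) (γ : Measure (Rd d × Rd d)) : ℝ≥0∞ := ∫⁻ p, ‖p.1 - p.2‖ₑ ^ r ∂γ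

lemma IsCoupling.isProbabilityMeasure {d : ℕ} {μ ν : Measure (Rd d)} [IsProbabilityMeasure μ]
    {γ : Measure (Rd d × Rd d)} (h : IsCoupling μ ν γ) : IsProbabilityMeasure γ := by
  constructor
  have h1 : γ.map Prod.fst univ = 1 := by rw [h.1]; exact measure_univ
  rwa [Measure.map_apply measurable_fst MeasurableSet.univ, preimage_univ] at h1

instance {d : ℕ} (μ : P2 d) : IsProbabilityMeasure μ.1 := μ.2.1

lemma lintegral_enorm_rpow_lt_top {d : ℕ} (μ : P2 d) {r : ℝ} (hr₀ : 0 ≤ r) (hr₂ : r ≤ 2) :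
    ∫⁻ x, ‖x‖ₑ ^ r ∂μ.1 < ∞ := by
  have h : ∀ x : Rd d, ‖x‖ₑ ^ r ≤ 1 + ‖x‖ₑ ^ (2 : ℝ) := fun x => by
    rcases le_total ‖x‖ₑ 1 with hx | hx
    · exact (ENNReal.rpow_le_one hx hr₀).trans le_self_add
    · exact (ENNReal.rpow_le_rpow_of_exponent_le hx hr₂).trans le_add_self
  refine (lintegral_mono h).trans_lt ?_
  rw [lintegral_add_left measurable_const]
  have h2 : ∫⁻ x, ‖x‖ₑ ^ (2 : ℝ) ∂μ.1 < ∞ := μ.2.2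
  exact ENNReal.add_lt_top.2 ⟨by simp, h2⟩

lemma cost_lt_top {d : ℕ} {μ ν : P2 d} {γ : Measure (Rd d × Rd d)}
    (hγ : IsCoupling μ.1 ν.1 γ) {r : ℝ} (hr₁ : 1 ≤ r) (hr₂ : r ≤ 2) : cost r γ < ∞ := by
  have h : ∀ p : Rd d × Rd d, ‖p.1 - p.2‖ₑ ^ r ≤
      (2 : ℝ≥0∞) ^ (r - 1) * (‖p.1‖ₑ ^ r + ‖p.2‖ₑ ^ r) := fun p =>
    (ENNReal.rpow_le_rpow enorm_sub_le (by linarith)).trans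
      (ENNReal.rpow_add_le_mul_rpow_add_rpow _ _ hr₁)
  refine (lintegral_mono h).trans_lt ?_
  rw [lintegral_const_mul _ (by fun_prop), lintegral_add_left (by fun_prop)]
  refine ENNReal.mul_lt_top (by finiteness) (ENNReal.add_lt_top.2 ⟨?_, ?_⟩)
  · rw [← lintegral_map (f := fun x : Rd d => ‖x‖ₑ ^ r) (by fun_prop) measurable_fst, hγ.1]
    exact lintegral_enorm_rpow_lt_top μ (by linarith) hr₂
  · rw [← lintegral_map (f := fun x : Rd d => ‖x‖ₑ ^ r) (by fun_prop) measurable_snd, hγ.2]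
    exact lintegral_enorm_rpow_lt_top ν (by linarith) hr₂

lemma isCoupling_prod {d : ℕ} (μ ν : Measure (Rd d)) [IsProbabilityMeasure μ]
    [IsProbabilityMeasure ν] : IsCoupling μ ν (μ.prod ν) :=
  ⟨by simp [Measure.map_fst_prod], by simp [Measure.map_snd_prod]⟩

lemma isCoupling_map {α : Type*} [MeasurableSpace α] {d : ℕ} (P : Measure α) {f g : α → Rd d}
    (hf : Measurable f) (hg : Measurable g) :
    IsCoupling (P.map f) (P.map g) (P.map fun a => (f a, g a)) := by
  constructor
  · rw [Measure.map_map measurable_fst (by fun_prop)]; rfl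
  · rw [Measure.map_map measurable_snd (by fun_prop)]; rfl

lemma exists_isCoupling_lt {d : ℕ} {r : ℝ} (hr₁ : 1 ≤ r) (hr₂ : r ≤ 2) (μ ν : P2 d) {ε : ℝ}
    (hε : 0 < ε) : ∃ γ, IsCoupling μ.1 ν.1 γ ∧
      cost r γ ^ (1 / r) < ENNReal.ofReal (wassersteinDist r μ ν + ε) := by
  set I : ℝ≥0∞ := ⨅ (γ : Measure (Rd d × Rd d)) (_ : IsCoupling μ.1 ν.1 γ),
    (∫⁻ p, ‖p.1 - p.2‖ₑ ^ r ∂γ) ^ (1 / r) with hI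
  -- `toReal` would send an infinite infimum to `0`; the product coupling rules this out.
  have hfin : I < ∞ := by
    refine (iInf₂_le (μ.1.prod ν.1) (isCoupling_prod μ.1 ν.1)).trans_lt ?_
    exact ENNReal.rpow_lt_top_of_nonneg (by positivity)
      (cost_lt_top (isCoupling_prod μ.1 ν.1) hr₁ hr₂).ne
  have hlt : I < ENNReal.ofReal (wassersteinDist r μ ν + ε) := by
    have h0 : wassersteinDist r μ ν = I.toReal := rfl
    rw [h0, ENNReal.ofReal_add ENNReal.toReal_nonneg hε.le, ENNReal.ofReal_toReal hfin.ne]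
    exact ENNReal.lt_add_right hfin.ne (by simpa using hε)
  obtain ⟨γ, h⟩ := iInf_lt_iff.1 hlt
  obtain ⟨hγ, h⟩ := iInf_lt_iff.1 h
  exact ⟨γ, hγ, h⟩

lemma wassersteinDist_nonneg {d : ℕ} (r : ℝ) (μ ν : P2 d) : 0 ≤ wassersteinDist r μ ν :=
  ENNReal.toReal_nonneg

lemma ofReal_wassersteinDist_le {d : ℕ} {r : ℝ} {μ ν : P2 d} {γ : Measure (Rd d × Rd d)}
    (hγ : IsCoupling μ.1 ν.1 γ) :
    ENNReal.ofReal (wassersteinDist r μ ν) ≤ cost r γ ^ (1 / r) :=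
  ENNReal.ofReal_toReal_le.trans (iInf₂_le γ hγ)

lemma IsLipschitzWith.mono {d : ℕ} {r C C' : ℝ} {φ : Rd d → P2 d → ℝ}
    (h : IsLipschitzWith r C φ) (hC : C ≤ C') : IsLipschitzWith r C' φ := fun x y μ β =>
  (h x y μ β).trans (mul_le_mul_of_nonneg_right hC
    (add_nonneg (norm_nonneg _) (wassersteinDist_nonneg _ _ _)))

/-- Working with extended norms and an arbitrary coupling lets later bounds be integrated without
integrability checks, and avoids optimal couplings. -/
lemma IsLipschitzWith.enorm_sub_le {d : ℕ} {r C : ℝ} (hC : 0 ≤ C) {φ : Rd d → P2 d → ℝ}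
    (h : IsLipschitzWith r C φ) (x y : Rd d) {μ β : P2 d} {γ : Measure (Rd d × Rd d)}
    (hγ : IsCoupling μ.1 β.1 γ) :
    ‖φ x μ - φ y β‖ₑ ≤ ENNReal.ofReal C * (‖x - y‖ₑ + cost r γ ^ (1 / r)) := by
  rw [Real.enorm_eq_ofReal_abs]
  refine (ENNReal.ofReal_le_ofReal (h x y μ β)).trans ?_
  rw [ENNReal.ofReal_mul hC, ENNReal.ofReal_add (norm_nonneg _) (wassersteinDist_nonneg _ _ _),
    ofReal_norm]
  gcongr
  exact ofReal_wassersteinDist_le hγ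

lemma abs_le_of_forall_isCoupling {d : ℕ} {r : ℝ} (hr₁ : 1 ≤ r) (hr₂ : r ≤ 2) {μ β : P2 d}
    {a A B : ℝ} (hA : 0 ≤ A) (hB : 0 ≤ B)
    (h : ∀ γ : Measure (Rd d × Rd d), IsCoupling μ.1 β.1 γ →
      ‖a‖ₑ ≤ ENNReal.ofReal A + ENNReal.ofReal B * cost r γ ^ (1 / r)) :
    |a| ≤ A + B * wassersteinDist r μ β := by
  refine le_of_forall_pos_le_add fun ε hε => ?_
  -- A coupling optimal up to this error loses at most `ε` after multiplication by `B`; the `+ 1`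
  -- covers `B = 0`.
  have hε' : 0 < ε / (B + 1) := by positivity
  obtain ⟨γ, hγ, hlt⟩ := exists_isCoupling_lt hr₁ hr₂ μ β hε'
  have hW := wassersteinDist_nonneg r μ β
  have h1 : ENNReal.ofReal |a| ≤
      ENNReal.ofReal (A + B * (wassersteinDist r μ β + ε / (B + 1))) := by
    rw [← Real.enorm_eq_ofReal_abs, ENNReal.ofReal_add hA (by positivity), ENNReal.ofReal_mul hB]
    refine (h γ hγ).trans ?_
    gcongr
  have h2 := (ENNReal.ofReal_le_ofReal_iff (by positivity)).1 h1
  have h3 : B * (ε / (B + 1)) ≤ ε := by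
    rw [← mul_div_assoc, div_le_iff₀ (by positivity)]; nlinarith
  linarith

lemma isLipschitzWith_of_enorm_sub_le {d : ℕ} {r C : ℝ} (hr₁ : 1 ≤ r) (hr₂ : r ≤ 2) (hC : 0 ≤ C)
    {f : Rd d → P2 d → ℝ}
    (h : ∀ (x y : Rd d) (μ β : P2 d) (γ : Measure (Rd d × Rd d)), IsCoupling μ.1 β.1 γ →
      ‖f x μ - f y β‖ₑ ≤ ENNReal.ofReal C * (‖x - y‖ₑ + cost r γ ^ (1 / r))) :
    IsLipschitzWith r C f := by
  intro x y μ β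
  rw [mul_add]
  refine abs_le_of_forall_isCoupling hr₁ hr₂ (by positivity) hC fun γ hγ => ?_
  rw [ENNReal.ofReal_mul hC, ofReal_norm, ← mul_add]
  exact h x y μ β γ hγ

/-! ### Empirical measures -/

lemma isCoupling_empirical {d N : ℕ} [NeZero N] (x y : Fin N → Rd d) :
    IsCoupling (empirical x).1 (empirical y).1
      ((N : ℝ≥0∞)⁻¹ • ∑ i, Measure.dirac (x i, y i)) := by
  constructor
  · simp only [empirical, Measure.map_smul, Measure.map_finset_sum measurable_fst.aemeasurable,
      Measure.map_dirac' measurable_fst]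
  · simp only [empirical, Measure.map_smul, Measure.map_finset_sum measurable_snd.aemeasurable,
      Measure.map_dirac' measurable_snd]

lemma cost_empirical {d N : ℕ} (r : ℝ) (x y : Fin N → Rd d) :
    cost r ((N : ℝ≥0∞)⁻¹ • ∑ i, Measure.dirac (x i, y i)) =
      (N : ℝ≥0∞)⁻¹ * ∑ i, ‖x i - y i‖ₑ ^ r := by
  simp [cost, lintegral_smul_measure, lintegral_finsetSum_measure]

lemma inv_mul_sum_const {N : ℕ} [NeZero N] (c : ℝ≥0∞) :
    (N : ℝ≥0∞)⁻¹ * ∑ _i : Fin N, c = c := by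
  have hN : (N : ℝ≥0∞) ≠ 0 := by exact_mod_cast NeZero.ne N
  rw [Finset.sum_const, Finset.card_univ, Fintype.card_fin, nsmul_eq_mul, ← mul_assoc,
    ENNReal.inv_mul_cancel hN (ENNReal.natCast_ne_top N), one_mul]

lemma mean_rpow_le {d N : ℕ} [NeZero N] {r : ℝ} (hr : 1 ≤ r) {x y : Fin N → Rd d} {c : ℝ≥0∞}
    (h : ∀ i, ‖x i - y i‖ₑ ≤ c) : ((N : ℝ≥0∞)⁻¹ * ∑ i, ‖x i - y i‖ₑ ^ r) ^ (1 / r) ≤ c := by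
  have hr0 : 0 < r := by linarith
  rw [one_div, ENNReal.rpow_inv_le_iff hr0]
  calc _ ≤ (N : ℝ≥0∞)⁻¹ * ∑ i : Fin N, c ^ r := by gcongr with i; exact h i
    _ = c ^ r := inv_mul_sum_const _

lemma IsLipschitzWith.enorm_sub_empirical_le {d N : ℕ} [NeZero N] {r C : ℝ} (hC : 0 ≤ C)
    {φ : Rd d → P2 d → ℝ} (h : IsLipschitzWith r C φ) (a b : Rd d) (x y : Fin N → Rd d) :
    ‖φ a (empirical x) - φ b (empirical y)‖ₑ ≤
      ENNReal.ofReal C * (‖a - b‖ₑ + ((N : ℝ≥0∞)⁻¹ * ∑ i, ‖x i - y i‖ₑ ^ r) ^ (1 / r)) := by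
  rw [← cost_empirical]
  exact h.enorm_sub_le hC a b (isCoupling_empirical x y)

/-- **Jensen's inequality** for the concave function `t ↦ t^{1/r}`. -/
lemma lintegral_rpow_inv_le {α : Type*} [MeasurableSpace α] {P : Measure α}
    [IsProbabilityMeasure P] {r : ℝ} (hr : 1 ≤ r) {f : α → ℝ≥0∞} (hf : AEMeasurable f P) :
    ∫⁻ a, f a ^ (1 / r) ∂P ≤ (∫⁻ a, f a ∂P) ^ (1 / r) := by
  have h := eLpNorm'_le_eLpNorm'_of_exponent_le (μ := P) (f := fun a => f a ^ (1 / r)) one_pos hr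
    (hf.pow_const _).aestronglyMeasurable
  have hr0 : r ≠ 0 := by linarith
  simpa [eLpNorm', ← ENNReal.rpow_mul, hr0] using h

/-- The function on `(ℝ^d)^{N+1}` obtained from `φ` by evaluation at empirical measures. -/
def onPoints {d : ℕ} (φ : Rd d → P2 d → ℝ) (N : ℕ) [NeZero N] (z : Fin (N + 1) → Rd d) : ℝ :=
  φ (z 0) (empirical fun i => z i.succ)

/-- The factor `2` adds the displacement of `z 0` and the power mean of the other displacements,
each at most the sup norm. -/
lemma IsLipschitzWith.lipschitzWith_onPoints {d N : ℕ} [NeZero N] {r C : ℝ} (hr : 1 ≤ r)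
    (hC : 0 ≤ C) {φ : Rd d → P2 d → ℝ} (h : IsLipschitzWith r C φ) :
    LipschitzWith (2 * C.toNNReal) (onPoints φ N) := by
  intro z w
  rw [edist_eq_enorm_sub, edist_eq_enorm_sub]
  have hz : ∀ i, ‖z i - w i‖ₑ ≤ ‖z - w‖ₑ := fun i => by
    rw [← ofReal_norm, ← ofReal_norm]
    exact ENNReal.ofReal_le_ofReal (norm_le_pi_norm (z - w) i)
  refine (h.enorm_sub_empirical_le hC _ _ _ _).trans ?_
  calc _ ≤ ENNReal.ofReal C * (‖z - w‖ₑ + ‖z - w‖ₑ) := by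
        gcongr
        · exact hz 0
        · exact mean_rpow_le hr fun i => hz i.succ
    _ = _ := by rw [← two_mul, ENNReal.coe_mul]; simp [ENNReal.ofReal]; ring

/-! ### Smooth functions all of whose derivatives of positive order are bounded -/

section BoundedDerivs

variable {U V W W' : Type} [NormedAddCommGroup U] [NormedSpace ℝ U]
  [NormedAddCommGroup V] [NormedSpace ℝ V] [NormedAddCommGroup W] [NormedSpace ℝ W]
  [NormedAddCommGroup W'] [NormedSpace ℝ W']

/-- `G` is smooth and all its derivatives of positive order are bounded. -/
def BoundedDerivs (G : V → W) : Prop :=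
  ContDiff ℝ ((⊤ : ℕ∞) : WithTop ℕ∞) G ∧ ∀ k : ℕ, ∃ C, ∀ x, ‖iteratedFDeriv ℝ (k + 1) G x‖ ≤ C

namespace BoundedDerivs

lemma contDiff_nat {G : V → W} (h : BoundedDerivs G) (n : ℕ) :
    ContDiff ℝ ((n : ℕ∞) : WithTop ℕ∞) G :=
  h.1.of_le (by exact_mod_cast le_top)

lemma differentiable {G : V → W} (h : BoundedDerivs G) : Differentiable ℝ G :=
  h.1.differentiable (by simp)

lemma hasFDerivAt {G : V → W} (h : BoundedDerivs G) (x : V) :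
    HasFDerivAt G (fderiv ℝ G x) x := (h.differentiable x).hasFDerivAt

lemma comp_clm {G : V → W} (h : BoundedDerivs G) (A : U →L[ℝ] V) :
    BoundedDerivs (fun x => G (A x)) := by
  refine ⟨h.1.comp A.contDiff, fun k => ?_⟩
  obtain ⟨C, hC⟩ := h.2 k
  refine ⟨C * ‖A‖ ^ (k + 1), fun x => ?_⟩
  have := A.iteratedFDeriv_comp_right (h.contDiff_nat (k + 1)) x (i := k + 1) le_rfl
  change ‖iteratedFDeriv ℝ (k + 1) (G ∘ A) x‖ ≤ _
  rw [this]
  refine (ContinuousMultilinearMap.norm_compContinuousLinearMap_le _ _).trans ?_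
  simp only [Finset.prod_const, Finset.card_univ, Fintype.card_fin]
  gcongr
  exact hC _

lemma clm_comp {G : V → W} (h : BoundedDerivs G) (A : W →L[ℝ] W') :
    BoundedDerivs (fun x => A (G x)) := by
  refine ⟨A.contDiff.comp h.1, fun k => ?_⟩
  obtain ⟨C, hC⟩ := h.2 k
  refine ⟨‖A‖ * C, fun x => ?_⟩
  refine (A.norm_iteratedFDeriv_comp_left (h.contDiff_nat (k + 1)).contDiffAt le_rfl).trans ?_
  gcongr
  exact hC _

lemma sum {ι : Type} {s : Finset ι} {G : ι → V → W} (h : ∀ i ∈ s, BoundedDerivs (G i)) :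
    BoundedDerivs (fun x => ∑ i ∈ s, G i x) := by
  refine ⟨ContDiff.sum fun i hi => (h i hi).1, fun k => ?_⟩
  choose! C hC using fun i (hi : i ∈ s) => (h i hi).2 k
  refine ⟨∑ i ∈ s, C i, fun x => ?_⟩
  rw [← iteratedFDerivWithin_univ, iteratedFDerivWithin_fun_sum_apply uniqueDiffOn_univ
    (mem_univ x) fun i hi => ((h i hi).contDiff_nat (k + 1)).contDiffAt.contDiffWithinAt]
  simp only [iteratedFDerivWithin_univ]
  exact norm_sum_le_of_le _ fun i hi => hC i hi x

lemma fderiv {G : V → W} (h : BoundedDerivs G) : BoundedDerivs (fderiv ℝ G) := by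
  refine ⟨h.1.fderiv_right (by exact_mod_cast le_top), fun k => ?_⟩
  obtain ⟨C, hC⟩ := h.2 (k + 1)
  exact ⟨C, fun x => by rw [norm_iteratedFDeriv_fderiv]; exact hC x⟩

lemma fderiv_apply {G : V → W} (h : BoundedDerivs G) (e : V) :
    BoundedDerivs (fun x => _root_.fderiv ℝ G x e) :=
  h.fderiv.clm_comp (ContinuousLinearMap.apply ℝ W e)

lemma exists_norm_fderiv_le {G : V → W} (h : BoundedDerivs G) :
    ∃ K : ℝ≥0, ∀ x, ‖_root_.fderiv ℝ G x‖₊ ≤ K := by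
  obtain ⟨C, hC⟩ := h.2 0
  refine ⟨C.toNNReal, fun x => ?_⟩
  rw [← norm_toNNReal]
  refine Real.toNNReal_le_toNNReal ?_
  rw [← norm_iteratedFDeriv_one]
  exact hC x

lemma exists_lipschitzWith {G : V → W} (h : BoundedDerivs G) : ∃ K : ℝ≥0, LipschitzWith K G := by
  obtain ⟨K, hK⟩ := h.exists_norm_fderiv_le
  exact ⟨K, lipschitzWith_of_nnnorm_fderiv_le h.differentiable hK⟩

end BoundedDerivs

variable [FiniteDimensional ℝ V] [MeasurableSpace V] [BorelSpace V] {P : Measure V}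
  [P.IsAddHaarMeasure]

/-- The kernel takes values in a general space `W` because derivatives of the mollifier serve as
kernels below. -/
lemma lipschitzWith_convolution {f : V → W} (hf : Continuous f) (hcf : HasCompactSupport f)
    {F : V → ℝ} {K : ℝ≥0} (hF : LipschitzWith K F) (L : W →L[ℝ] ℝ →L[ℝ] W') :
    ∃ K' : ℝ≥0, LipschitzWith K' (convolution f F L P) := by
  refine ⟨(‖L‖ * K * ∫ t, ‖f t‖ ∂P).toNNReal, LipschitzWith.of_dist_le_mul fun x y => ?_⟩
  have hloc : LocallyIntegrable F P := hF.continuous.locallyIntegrable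
  have hx : Integrable (fun t => L (f t) (F (x - t))) P :=
    hcf.convolutionExists_left L hf hloc x
  have hy : Integrable (fun t => L (f t) (F (y - t))) P :=
    hcf.convolutionExists_left L hf hloc y
  have hint : Integrable (fun t => ‖f t‖) P := (hf.integrable_of_hasCompactSupport hcf).norm
  rw [Real.coe_toNNReal _ (by positivity), dist_eq_norm, convolution_def, convolution_def,
    ← integral_sub hx hy]
  have : ‖L‖ * K * (∫ t, ‖f t‖ ∂P) * dist x y = ∫ t, ‖L‖ * K * dist x y * ‖f t‖ ∂P := by
    rw [integral_const_mul]; ring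
  rw [this]
  refine norm_integral_le_of_norm_le (hint.const_mul _) (Eventually.of_forall fun t => ?_)
  rw [← map_sub]
  have h1 := (L (f t)).le_opNorm (F (x - t) - F (y - t))
  have h2 := L.le_opNorm (f t)
  have h3 : ‖F (x - t) - F (y - t)‖ ≤ K * dist x y := by
    have := hF.dist_le_mul (x - t) (y - t)
    rwa [dist_eq_norm, dist_sub_right] at this
  calc _ ≤ ‖L‖ * ‖f t‖ * (K * dist x y) := h1.trans (by gcongr)
    _ = _ := by ring

/-- All derivatives can be put on `f`, so each derivative of the convolution is a convolution of the
same kind, hence Lipschitz, and its own derivative is bounded. `F` may grow linearly, so order zero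
has to be excluded. -/
lemma boundedDerivs_convolution {f : V → W} (hf : ContDiff ℝ ((⊤ : ℕ∞) : WithTop ℕ∞) f)
    (hcf : HasCompactSupport f) {F : V → ℝ} {K : ℝ≥0} (hF : LipschitzWith K F)
    (L : W →L[ℝ] ℝ →L[ℝ] W') : BoundedDerivs (convolution f F L P) := by
  have hloc : LocallyIntegrable F P := hF.continuous.locallyIntegrable
  refine ⟨hcf.contDiff_convolution_left L hf hloc, fun k => ?_⟩
  induction k generalizing W W' with
  | zero =>
    obtain ⟨K', hK'⟩ := lipschitzWith_convolution (P := P) hf.continuous hcf hF L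
    refine ⟨K', fun x => ?_⟩
    rw [zero_add, norm_iteratedFDeriv_one]
    exact norm_fderiv_le_of_lipschitz ℝ hK'
  | succ k ih =>
    have hd : fderiv ℝ (convolution f F L P) =
        convolution (fderiv ℝ f) F (L.precompL V) P := by
      ext1 x
      exact (hcf.hasFDerivAt_convolution_left L (hf.of_le (by exact_mod_cast le_top)) hloc x).fderiv
    obtain ⟨C, hC⟩ := ih (hf.fderiv_right (m := ((⊤ : ℕ∞) : WithTop ℕ∞))
      (by exact_mod_cast le_top)) (hcf.fderiv ℝ) (L.precompL V)
    refine ⟨C, fun x => ?_⟩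
    rw [← norm_iteratedFDeriv_fderiv, hd]
    exact hC x

end BoundedDerivs

/-! ### The mollifier -/

/-- Smoothness across the unit sphere is inherited from `expNegInvGlue`. -/
lemma bump_eq {d : ℕ} (x : Rd d) : bump x = expNegInvGlue (1 - ‖x‖ ^ 2) := by
  unfold bump expNegInvGlue
  by_cases h : ‖x‖ < 1
  · have h2 : ¬ (1 - ‖x‖ ^ 2 ≤ 0) := by nlinarith [norm_nonneg x]
    rw [if_pos h, if_neg h2]
    congr 1
    rw [one_div, ← inv_neg, neg_sub]
  · have h2 : 1 - ‖x‖ ^ 2 ≤ 0 := by nlinarith [norm_nonneg x]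
    rw [if_neg h, if_pos h2]

lemma contDiff_bump {d : ℕ} : ContDiff ℝ ((⊤ : ℕ∞) : WithTop ℕ∞) (bump : Rd d → ℝ) := by
  have : (bump : Rd d → ℝ) = fun x => expNegInvGlue (1 - ‖x‖ ^ 2) := funext bump_eq
  rw [this]
  exact expNegInvGlue.contDiff.comp (contDiff_const.sub (contDiff_norm_sq ℝ))

lemma bump_nonneg {d : ℕ} (x : Rd d) : 0 ≤ bump x := by
  rw [bump_eq]; exact expNegInvGlue.nonneg _

lemma bump_eq_zero {d : ℕ} {x : Rd d} (hx : 1 ≤ ‖x‖) : bump x = 0 := if_neg (not_lt.2 hx)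

lemma hasCompactSupport_bump {d : ℕ} : HasCompactSupport (bump : Rd d → ℝ) :=
  HasCompactSupport.of_support_subset_isCompact (isCompact_closedBall 0 1) fun x hx => by
    rw [mem_closedBall_zero_iff]
    by_contra h
    exact hx (bump_eq_zero (not_le.1 h).le)

lemma integral_bump_pos {d : ℕ} : 0 < ∫ x : Rd d, bump x :=
  contDiff_bump.continuous.integral_pos_of_hasCompactSupport_nonneg_nonzero
    hasCompactSupport_bump bump_nonneg (x := 0) (by simp [bump, Real.exp_ne_zero])

lemma mollifier_nonneg {d : ℕ} {ε : ℝ} (hε : 0 < ε) (x : Rd d) : 0 ≤ mollifier ε x :=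
  mul_nonneg (by positivity) (div_nonneg (bump_nonneg _) integral_bump_pos.le)

lemma mollifier_eq_zero {d : ℕ} {ε : ℝ} (hε : 0 < ε) {x : Rd d} (hx : ε ≤ ‖x‖) :
    mollifier ε x = 0 := by
  unfold mollifier
  rw [bump_eq_zero, zero_div, mul_zero]
  rw [norm_smul, norm_inv, Real.norm_of_nonneg hε.le, ← div_eq_inv_mul, le_div_iff₀ hε]
  linarith

lemma contDiff_mollifier {d : ℕ} (ε : ℝ) :
    ContDiff ℝ ((⊤ : ℕ∞) : WithTop ℕ∞) (mollifier ε : Rd d → ℝ) := by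
  unfold mollifier
  exact contDiff_const.mul ((contDiff_bump.comp (contDiff_const_smul _)).div_const _)

lemma integral_mollifier {d : ℕ} {ε : ℝ} (hε : 0 < ε) : ∫ x : Rd d, mollifier ε x = 1 := by
  unfold mollifier
  rw [integral_const_mul, integral_div, Measure.integral_comp_inv_smul_of_nonneg _ _ hε.le]
  have := (integral_bump_pos (d := d)).ne'
  simp only [finrank_euclideanSpace, Fintype.card_fin, smul_eq_mul]
  field_simp

/-- The mollifier `η_ε(y₀) ⋯ η_ε(y_N)` on `(ℝ^d)^{N+1}`. -/
def prodMollifier {d N : ℕ} (ε : ℝ) (y : Fin N → Rd d) : ℝ := ∏ i, mollifier ε (y i)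

lemma contDiff_prodMollifier {d N : ℕ} (ε : ℝ) :
    ContDiff ℝ ((⊤ : ℕ∞) : WithTop ℕ∞) (prodMollifier ε : (Fin N → Rd d) → ℝ) := by
  unfold prodMollifier
  exact contDiff_prod fun i _ => (contDiff_mollifier ε).comp (contDiff_apply ℝ (Rd d) i)

lemma prodMollifier_nonneg {d N : ℕ} {ε : ℝ} (hε : 0 < ε) (y : Fin N → Rd d) :
    0 ≤ prodMollifier ε y := Finset.prod_nonneg fun i _ => mollifier_nonneg hε (y i)

lemma prodMollifier_eq_zero {d N : ℕ} {ε : ℝ} (hε : 0 < ε) {y : Fin N → Rd d} {i : Fin N}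
    (hi : ε ≤ ‖y i‖) : prodMollifier ε y = 0 :=
  Finset.prod_eq_zero (Finset.mem_univ i) (mollifier_eq_zero hε hi)

lemma hasCompactSupport_prodMollifier {d N : ℕ} {ε : ℝ} (hε : 0 < ε) :
    HasCompactSupport (prodMollifier ε : (Fin N → Rd d) → ℝ) :=
  HasCompactSupport.of_support_subset_isCompact (isCompact_closedBall 0 ε) fun x hx => by
    rw [mem_closedBall_zero_iff, pi_norm_le_iff_of_nonneg hε.le]
    intro i
    by_contra h
    exact hx (prodMollifier_eq_zero hε (not_le.1 h).le)

lemma integral_prodMollifier {d N : ℕ} {ε : ℝ} (hε : 0 < ε) :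
    ∫ y : Fin N → Rd d, prodMollifier ε y = 1 := by
  unfold prodMollifier
  rw [integral_fintype_prod_volume_eq_prod (fun _ => mollifier ε)]
  simp [integral_mollifier hε]

lemma integrable_prodMollifier {d N : ℕ} {ε : ℝ} (hε : 0 < ε) :
    Integrable (prodMollifier ε : (Fin N → Rd d) → ℝ) :=
  (contDiff_prodMollifier ε).continuous.integrable_of_hasCompactSupport
    (hasCompactSupport_prodMollifier hε)

lemma lintegral_prodMollifier {d N : ℕ} {ε : ℝ} (hε : 0 < ε) :
    ∫⁻ y : Fin N → Rd d, ENNReal.ofReal (prodMollifier ε y) = 1 := by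
  rw [← ofReal_integral_eq_lintegral_ofReal (integrable_prodMollifier hε)
    (Eventually.of_forall (prodMollifier_nonneg hε)), integral_prodMollifier hε, ENNReal.ofReal_one]

/-- The mollification of `φ` on `(ℝ^d)^{N+1}`, as a function of all its variables. -/
def mollifyAll {d : ℕ} (φ : Rd d → P2 d → ℝ) (N : ℕ) [NeZero N] (ε : ℝ)
    (z : Fin (N + 1) → Rd d) : ℝ := ∫ y, prodMollifier ε y * onPoints φ N (z - y)

lemma mollify_eq_mollifyAll {d : ℕ} (φ : Rd d → P2 d → ℝ) (N : ℕ) [NeZero N] (ε : ℝ)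
    (x₀ : Rd d) (x : Fin N → Rd d) :
    mollify φ N ε x₀ x = mollifyAll φ N ε (Fin.cons x₀ x) := by
  unfold mollify mollifyAll onPoints prodMollifier
  refine integral_congr_ae (Eventually.of_forall fun y => ?_)
  simp only [Pi.sub_apply, Fin.cons_zero, Fin.cons_succ]
  ring

lemma IsLipschitzWith.boundedDerivs_mollifyAll {d N : ℕ} [NeZero N] {r C ε : ℝ} (hr : 1 ≤ r)
    (hC : 0 ≤ C) (hε : 0 < ε) {φ : Rd d → P2 d → ℝ} (h : IsLipschitzWith r C φ) :
    BoundedDerivs (mollifyAll φ N ε) :=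
  boundedDerivs_convolution (P := volume) (contDiff_prodMollifier ε)
    (hasCompactSupport_prodMollifier hε) (h.lipschitzWith_onPoints hr hC)
    (ContinuousLinearMap.lsmul ℝ ℝ)

lemma IsLipschitzWith.integrable_mollifyAll_integrand {d N : ℕ} [NeZero N] {r C ε : ℝ}
    (hr : 1 ≤ r) (hC : 0 ≤ C) (hε : 0 < ε) {φ : Rd d → P2 d → ℝ} (h : IsLipschitzWith r C φ)
    (z : Fin (N + 1) → Rd d) :
    Integrable fun y => prodMollifier ε y * onPoints φ N (z - y) :=
  (hasCompactSupport_prodMollifier hε).convolutionExists_left_of_continuous_right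
    (ContinuousLinearMap.lsmul ℝ ℝ) (contDiff_prodMollifier ε).continuous.locallyIntegrable
    (h.lipschitzWith_onPoints hr hC).continuous z

/-! ### Integral functionals on `L²` -/

lemma integrable_comp_of_lipschitzWith {Ω H F : Type} [MeasurableSpace Ω] {P : Measure Ω}
    [IsFiniteMeasure P] [NormedAddCommGroup H] [NormedAddCommGroup F] {G : H → F} {K : ℝ≥0}
    (hG : LipschitzWith K G) {U : Ω → H} (hU : Integrable U P) :
    Integrable (fun ω => G (U ω)) P := by
  refine Integrable.mono' (g := fun ω => ‖G 0‖ + K * ‖U ω‖)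
    ((integrable_const _).add (hU.norm.const_mul _))
    (hG.continuous.comp_aestronglyMeasurable hU.aestronglyMeasurable)
    (Eventually.of_forall fun ω => ?_)
  have h1 := hG.dist_le_mul (U ω) 0
  rw [dist_eq_norm, dist_zero_right] at h1
  have h2 := norm_le_norm_add_norm_sub (G 0) (G (U ω))
  rw [norm_sub_rev] at h1
  linarith

lemma integral_norm_sq_eq {Ω H : Type} [MeasurableSpace Ω] {P : Measure Ω}
    [NormedAddCommGroup H] (U : Lp H 2 P) : ∫ ω, ‖U ω‖ ^ 2 ∂P = ‖U‖ ^ 2 := by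
  rw [Lp.norm_def, (Lp.memLp U).eLpNorm_eq_integral_rpow_norm (by norm_num) (by norm_num)]
  have h0 : 0 ≤ ∫ ω, ‖U ω‖ ^ 2 ∂P := integral_nonneg fun ω => by positivity
  rw [ENNReal.toReal_ofReal (by positivity)]
  simp only [ENNReal.toReal_ofNat, Real.rpow_ofNat]
  rw [← Real.rpow_natCast, ← Real.rpow_mul h0]
  norm_num

lemma integrable_norm_sq {Ω H : Type} [MeasurableSpace Ω] {P : Measure Ω}
    [NormedAddCommGroup H] (U : Lp H 2 P) : Integrable (fun ω => ‖U ω‖ ^ 2) P :=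
  (Lp.memLp U).integrable_norm_pow (by norm_num)

section Nemytskii

variable {Ω H : Type} [MeasurableSpace Ω] {P : Measure Ω} [IsProbabilityMeasure P]
  [NormedAddCommGroup H] [NormedSpace ℝ H]

variable {G : H → ℝ}

lemma BoundedDerivs.memLp_fderiv_comp (hG : BoundedDerivs G) {U : Ω → H}
    (hU : AEStronglyMeasurable U P) (p : ℝ≥0∞) : MemLp (fun ω => _root_.fderiv ℝ G (U ω)) p P := by
  obtain ⟨K, hK⟩ := hG.exists_norm_fderiv_le
  exact MemLp.of_bound (hG.fderiv.1.continuous.comp_aestronglyMeasurable hU) K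
    (Eventually.of_forall fun ω => hK _)

/-- The derivative at `U` of the functional `U ↦ ∫ G(U)` on `L²`. -/
def integralDeriv (hG : BoundedDerivs G) (U : Lp H 2 P) : Lp H 2 P →L[ℝ] ℝ :=
  (ContinuousLinearMap.id ℝ (H →L[ℝ] ℝ)).lpPairing P 2 2
    ((hG.memLp_fderiv_comp (Lp.aestronglyMeasurable U) 2).toLp _)

lemma integralDeriv_apply (hG : BoundedDerivs G) (U V : Lp H 2 P) :
    integralDeriv hG U V = ∫ ω, fderiv ℝ G (U ω) (V ω) ∂P := by
  rw [integralDeriv, ContinuousLinearMap.lpPairing_eq_integral]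
  refine integral_congr_ae ?_
  filter_upwards [(hG.memLp_fderiv_comp (Lp.aestronglyMeasurable U) 2).coeFn_toLp] with ω hω
  rw [hω]; rfl

/-- The map `U ↦ DG(U)` is Lipschitz from `L²` to `L²` because `DG` is Lipschitz pointwise, and the
`L²` pairing is continuous and linear. -/
lemma exists_lipschitzWith_integralDeriv (hG : BoundedDerivs G) :
    ∃ K : ℝ≥0, LipschitzWith K (integralDeriv (P := P) hG) := by
  obtain ⟨K, hK⟩ := hG.fderiv.exists_lipschitzWith
  have h : LipschitzWith K fun U : Lp H 2 P =>
      (hG.memLp_fderiv_comp (Lp.aestronglyMeasurable U) 2).toLp _ := by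
    refine LipschitzWith.of_dist_le_mul fun U V => ?_
    rw [dist_eq_norm, dist_eq_norm]
    refine Lp.norm_le_mul_norm_of_ae_le_mul ?_
    filter_upwards [Lp.coeFn_sub U V, Lp.coeFn_sub
      ((hG.memLp_fderiv_comp (Lp.aestronglyMeasurable U) 2).toLp _)
      ((hG.memLp_fderiv_comp (Lp.aestronglyMeasurable V) 2).toLp _),
      (hG.memLp_fderiv_comp (Lp.aestronglyMeasurable U) 2).coeFn_toLp,
      (hG.memLp_fderiv_comp (Lp.aestronglyMeasurable V) 2).coeFn_toLp] with ω h1 h2 h3 h4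
    rw [h1, h2, Pi.sub_apply, Pi.sub_apply, h3, h4, ← dist_eq_norm, ← dist_eq_norm]
    exact hK.dist_le_mul _ _
  exact ⟨_, (ContinuousLinearMap.lipschitz
    ((ContinuousLinearMap.id ℝ (H →L[ℝ] ℝ)).lpPairing P 2 2)).comp h⟩

/-- Mean value inequality on the ball of radius `‖v‖` about `x`, where the derivative differs from
the one at `x` by at most `K * ‖v‖`. -/
lemma norm_taylor_le {K : ℝ≥0} (hG : Differentiable ℝ G) (hK : LipschitzWith K (fderiv ℝ G))
    (x v : H) : ‖G (x + v) - G x - fderiv ℝ G x v‖ ≤ K * ‖v‖ ^ 2 := by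
  have := (convex_closedBall x ‖v‖).norm_image_sub_le_of_norm_hasFDerivWithin_le'
    (f := G) (f' := fderiv ℝ G) (φ := fderiv ℝ G x) (C := K * ‖v‖) (x := x) (y := x + v)
    (fun y _ => (hG y).hasFDerivAt.hasFDerivWithinAt) (fun y hy => ?_) (by simp) (by simp)
  · rw [add_sub_cancel_left] at this
    calc _ ≤ _ := this
      _ = _ := by ring
  · rw [← dist_eq_norm]
    exact (hK.dist_le_mul y x).trans (by gcongr; exact hy)

lemma hasFDerivAt_integral_comp (hG : BoundedDerivs G) (U : Lp H 2 P) :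
    HasFDerivAt (fun U : Lp H 2 P => ∫ ω, G (U ω) ∂P) (integralDeriv hG U) U := by
  obtain ⟨L, hL⟩ := hG.exists_lipschitzWith
  obtain ⟨K, hK⟩ := hG.fderiv.exists_lipschitzWith
  have hint : ∀ U : Lp H 2 P, Integrable (fun ω => G (U ω)) P := fun U =>
    integrable_comp_of_lipschitzWith hL ((Lp.memLp U).integrable (by norm_num))
  rw [hasFDerivAt_iff_isLittleO_nhds_zero]
  refine (Asymptotics.IsBigO.of_bound (g := fun V : Lp H 2 P => ‖V‖ ^ 2) K
    (Eventually.of_forall fun V => ?_)).trans_isLittleO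
      (Asymptotics.isLittleO_norm_pow_id one_lt_two)
  have hD : Integrable (fun ω => fderiv ℝ G (U ω) (V ω)) P := by
    have := (ContinuousLinearMap.id ℝ (H →L[ℝ] ℝ)).memLp_of_bilin (p := 2) (q := 2) 1
      (hG.memLp_fderiv_comp (Lp.aestronglyMeasurable U) 2) (Lp.memLp V)
    exact memLp_one_iff_integrable.1 this
  have hadd : ∫ ω, G ((U + V : Lp H 2 P) ω) ∂P = ∫ ω, G (U ω + V ω) ∂P := by
    refine integral_congr_ae ?_
    filter_upwards [Lp.coeFn_add U V] with ω hω
    rw [hω]; rfl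
  have hint' : Integrable (fun ω => G (U ω + V ω)) P := by
    refine (hint (U + V)).congr ?_
    filter_upwards [Lp.coeFn_add U V] with ω hω
    rw [hω]; rfl
  rw [hadd, integralDeriv_apply, ← integral_sub hint' (hint U),
    ← integral_sub (f := fun ω => G (U ω + V ω) - G (U ω)) (hint'.sub (hint U)) hD,
    norm_pow, norm_norm, ← integral_norm_sq_eq,
    ← integral_const_mul]
  exact norm_integral_le_of_norm_le ((integrable_norm_sq V).const_mul _)
    (Eventually.of_forall fun ω => norm_taylor_le hG.differentiable hK _ _)

end Nemytskii

/-! ### Averages over independent samples -/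

section Average

variable {V : Type} [NormedAddCommGroup V] [NormedSpace ℝ V] {d N : ℕ}

/-- The average `𝔼[G(v, X₁, …, X_N)]` over independent `X₁, …, X_N` of law `μ`. -/
def average (G : V × (Fin N → Rd d) → ℝ) (v : V) (μ : P2 d) : ℝ :=
  ∫ x, G (v, x) ∂(Measure.pi fun _ : Fin N => μ.1)

/-- Lebesgue measure on `(0,1)^N`. -/
abbrev cubeMeasure (N : ℕ) : Measure (Fin N → ℝ) := Measure.pi fun _ => unitMeasure

/-- The map `(v, X) ↦ (v, X(ω₁), …, X(ω_N))`, as a linear map into `L²`. -/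
def sample (V : Type) [NormedAddCommGroup V] [NormedSpace ℝ V] (d N : ℕ) :
    V × E d →L[ℝ] Lp (V × (Fin N → Rd d)) 2 (cubeMeasure N) :=
  ((ContinuousLinearMap.inl ℝ V (Fin N → Rd d)).compLpL 2 (cubeMeasure N) ∘L
      Lp.constL 2 (cubeMeasure N) ℝ) ∘L ContinuousLinearMap.fst ℝ V (E d) +
  (∑ i, (ContinuousLinearMap.inr ℝ V (Fin N → Rd d) ∘L
      ContinuousLinearMap.single ℝ (fun _ => Rd d) i).compLpL 2 (cubeMeasure N) ∘L
    (Lp.compMeasurePreservingₗᵢ ℝ (Function.eval i)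
      (measurePreserving_eval (fun _ => unitMeasure) i)).toContinuousLinearMap) ∘L
    ContinuousLinearMap.snd ℝ V (E d)

lemma coeFn_sample (v : V) (X : E d) :
    (sample V d N (v, X) : (Fin N → ℝ) → V × (Fin N → Rd d)) =ᵐ[cubeMeasure N]
      fun ω => (v, fun i => X (ω i)) := by
  have h1 : ∀ i : Fin N, ∀ᵐ ω ∂(cubeMeasure N),
      (((ContinuousLinearMap.inr ℝ V (Fin N → Rd d) ∘L
        ContinuousLinearMap.single ℝ (fun _ => Rd d) i).compLpL 2 (cubeMeasure N)
        (Lp.compMeasurePreserving (Function.eval i)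
          (measurePreserving_eval (fun _ => unitMeasure) i) X) : Lp _ 2 (cubeMeasure N)) :
        (Fin N → ℝ) → V × (Fin N → Rd d)) ω = (0, Pi.single i (X (ω i))) := fun i => by
    filter_upwards [ContinuousLinearMap.coeFn_compLpL (p := 2) (μ := cubeMeasure N)
      (ContinuousLinearMap.inr ℝ V (Fin N → Rd d) ∘L
        ContinuousLinearMap.single ℝ (fun _ => Rd d) i) (Lp.compMeasurePreserving (Function.eval i)
          (measurePreserving_eval (fun _ => unitMeasure) i) X),
      Lp.coeFn_compMeasurePreserving X (measurePreserving_eval (fun _ => unitMeasure) i)]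
      with ω h2 h3
    rw [h2, h3]; rfl
  have h2 := ContinuousLinearMap.coeFn_compLpL (p := 2) (μ := cubeMeasure N)
    (ContinuousLinearMap.inl ℝ V (Fin N → Rd d)) (Lp.const 2 (cubeMeasure N) v)
  have h3 : sample V d N (v, X) =
      (ContinuousLinearMap.inl ℝ V (Fin N → Rd d)).compLpL 2 (cubeMeasure N)
        (Lp.const 2 (cubeMeasure N) v) +
      ∑ i, (ContinuousLinearMap.inr ℝ V (Fin N → Rd d) ∘L
        ContinuousLinearMap.single ℝ (fun _ => Rd d) i).compLpL 2 (cubeMeasure N)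
        (Lp.compMeasurePreserving (Function.eval i)
          (measurePreserving_eval (fun _ => unitMeasure) i) X) := by
    simp [sample, Lp.constL_apply]
    rfl
  rw [h3]
  filter_upwards [Lp.coeFn_add ((ContinuousLinearMap.inl ℝ V (Fin N → Rd d)).compLpL 2
      (cubeMeasure N) (Lp.const 2 (cubeMeasure N) v))
      (∑ i, (ContinuousLinearMap.inr ℝ V (Fin N → Rd d) ∘L
        ContinuousLinearMap.single ℝ (fun _ => Rd d) i).compLpL 2 (cubeMeasure N)
        (Lp.compMeasurePreserving (Function.eval i)
          (measurePreserving_eval (fun _ => unitMeasure) i) X)), ae_all_iff.2 h1, h2,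
    Lp.coeFn_finsetSum Finset.univ fun i => (ContinuousLinearMap.inr ℝ V (Fin N → Rd d) ∘L
        ContinuousLinearMap.single ℝ (fun _ => Rd d) i).compLpL 2 (cubeMeasure N)
        (Lp.compMeasurePreserving (Function.eval i)
          (measurePreserving_eval (fun _ => unitMeasure) i) X),
    Lp.coeFn_const (p := 2) (μ := cubeMeasure N) v] with ω g1 g2 g3 g4 g5
  rw [g1, Pi.add_apply, g3, g4, g5]
  simp only [Finset.sum_apply, g2, Function.const_apply, ContinuousLinearMap.inl_apply]
  ext : 1
  · simp [Prod.fst_sum]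
  · simp only [Prod.snd_add, Prod.snd_sum, zero_add]
    exact Finset.univ_sum_single _

lemma pi_map_law (X : E d) :
    (Measure.pi fun _ : Fin N => (law X).1) = (cubeMeasure N).map fun ω i => X (ω i) :=
  (Measure.pi_map_pi fun _ => (Lp.aestronglyMeasurable X).aemeasurable).symm

lemma aemeasurable_sample (X : E d) :
    AEMeasurable (fun ω (i : Fin N) => X (ω i)) (cubeMeasure N) :=
  aemeasurable_pi_lambda _ fun i =>
    ((Lp.aestronglyMeasurable X).comp_measurePreserving
      (measurePreserving_eval (fun _ => unitMeasure) i)).aemeasurable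

/-- The values `X (ω i)` are independent copies of `X`; this turns the lift of an average into an
integral functional composed with the linear map `sample`. -/
lemma average_law {G : V × (Fin N → Rd d) → ℝ} (hG : Continuous G) (v : V) (X : E d) :
    average G v (law X) = ∫ ω, G (sample V d N (v, X) ω) ∂(cubeMeasure N) := by
  rw [average, pi_map_law, integral_map (aemeasurable_sample X)
    (f := fun x => G (v, x))
    (hG.comp (Continuous.prodMk_right v)).aestronglyMeasurable]
  refine integral_congr_ae ?_
  filter_upwards [coeFn_sample (N := N) v X] with ω hω
  rw [hω]

variable {G : V × (Fin N → Rd d) → ℝ}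

lemma hasFDerivAt_lift_average (hG : BoundedDerivs G) (p : V × E d) :
    HasFDerivAt (lift (average G)) (integralDeriv hG (sample V d N p) ∘L sample V d N) p := by
  have : lift (average G) = (fun U : Lp (V × (Fin N → Rd d)) 2 (cubeMeasure N) =>
      ∫ ω, G (U ω) ∂(cubeMeasure N)) ∘ sample V d N :=
    funext fun p => average_law hG.1.continuous p.1 p.2
  rw [this]
  exact (hasFDerivAt_integral_comp hG _).comp p (sample V d N).hasFDerivAt

lemma isC11_lift_average (hG : BoundedDerivs G) : IsC11 (lift (average G)) := by
  refine ⟨fun p => (hasFDerivAt_lift_average hG p).differentiableAt, ?_⟩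
  obtain ⟨K, hK⟩ := exists_lipschitzWith_integralDeriv (P := cubeMeasure N) hG
  have h : fderiv ℝ (lift (average G)) =
      (fun A => A ∘L sample V d N) ∘ integralDeriv hG ∘ sample V d N :=
    funext fun p => (hasFDerivAt_lift_average hG p).fderiv
  rw [h]
  exact ⟨_, (((ContinuousLinearMap.compL ℝ (V × E d) _ ℝ).flip (sample V d N)).lipschitz).comp
    (hK.comp (sample V d N).lipschitz)⟩

lemma contDiff_one_lift_average (hG : BoundedDerivs G) : ContDiff ℝ 1 (lift (average G)) := by
  obtain ⟨h, K, hK⟩ := isC11_lift_average hG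
  exact contDiff_one_iff_fderiv.2 ⟨h, hK.continuous⟩

end Average

/-! ### Continuity and derivatives of averages in `v` and in `μ`. -/

section AverageDerivatives

variable {V : Type} [NormedAddCommGroup V] {d N : ℕ}

lemma integrable_pi_of_lipschitzWith {F : Type} [NormedAddCommGroup F]
    {G : V × (Fin N → Rd d) → F} {K : ℝ≥0} (hG : LipschitzWith K G) (v : V) (μ : P2 d) :
    Integrable (fun x => G (v, x)) (Measure.pi fun _ : Fin N => μ.1) := by
  have hid : Integrable (fun x : Rd d => x) μ.1 := by
    refine ⟨aestronglyMeasurable_id, ?_⟩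
    have := lintegral_enorm_rpow_lt_top μ zero_le_one one_le_two
    simp only [ENNReal.rpow_one] at this
    exact this
  have h1 : Integrable (fun x : Fin N → Rd d => x) (Measure.pi fun _ : Fin N => μ.1) :=
    Integrable.of_eval fun i =>
    integrable_comp_eval (μ := fun _ : Fin N => μ.1) (f := fun x => x) hid
  have h2 : LipschitzWith K fun x => G (v, x) := by
    have := hG.comp (LipschitzWith.prodMk_left v)
    rwa [mul_one] at this
  exact integrable_comp_of_lipschitzWith h2 h1

/-- The increment of an average is controlled by the product of any coupling with itself. -/
lemma enorm_average_sub_le {G : V × (Fin N → Rd d) → ℝ} {K : ℝ≥0} (hG : LipschitzWith K G)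
    (v w : V) {μ ν : P2 d} {γ : Measure (Rd d × Rd d)} (hγ : IsCoupling μ.1 ν.1 γ) :
    ‖average G v μ - average G w ν‖ₑ ≤
      ∫⁻ p, ‖G (v, fun i => (p i).1) - G (w, fun i => (p i).2)‖ₑ
        ∂(Measure.pi fun _ : Fin N => γ) := by
  have := hγ.isProbabilityMeasure
  have hfst : MeasurePreserving (fun (p : Fin N → Rd d × Rd d) i => (p i).1)
      (Measure.pi fun _ => γ) (Measure.pi fun _ => μ.1) :=
    measurePreserving_pi _ _ fun _ => ⟨measurable_fst, hγ.1⟩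
  have hsnd : MeasurePreserving (fun (p : Fin N → Rd d × Rd d) i => (p i).2)
      (Measure.pi fun _ => γ) (Measure.pi fun _ => ν.1) :=
    measurePreserving_pi _ _ fun _ => ⟨measurable_snd, hγ.2⟩
  have iv := integrable_pi_of_lipschitzWith hG v μ
  have iw := integrable_pi_of_lipschitzWith hG w ν
  have e1 : average G v μ = ∫ p, G (v, fun i => (p i).1) ∂(Measure.pi fun _ : Fin N => γ) := by
    rw [average, ← hfst.map_eq, integral_map hfst.measurable.aemeasurable]
    rw [hfst.map_eq]; exact iv.aestronglyMeasurable
  have e2 : average G w ν = ∫ p, G (w, fun i => (p i).2) ∂(Measure.pi fun _ : Fin N => γ) := by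
    rw [average, ← hsnd.map_eq, integral_map hsnd.measurable.aemeasurable]
    rw [hsnd.map_eq]; exact iw.aestronglyMeasurable
  have iv' : Integrable (fun p => G (v, fun i => (p i).1)) (Measure.pi fun _ : Fin N => γ) :=
    hfst.integrable_comp_of_integrable iv
  have iw' : Integrable (fun p => G (w, fun i => (p i).2)) (Measure.pi fun _ : Fin N => γ) :=
    hsnd.integrable_comp_of_integrable iw
  rw [e1, e2, ← integral_sub iv' iw']
  exact enorm_integral_le_lintegral_enorm _

lemma lintegral_pi_eval {α : Type} [MeasurableSpace α] {P : Measure α} [IsProbabilityMeasure P]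
    {f : α → ℝ≥0∞} (hf : Measurable f) (i : Fin N) :
    ∫⁻ p, f (p i) ∂(Measure.pi fun _ : Fin N => P) = ∫⁻ a, f a ∂P :=
  (measurePreserving_eval (fun _ : Fin N => P) i).lintegral_comp hf

/-- The sup distance between two samples is at most the sum of the coordinate distances, each of
mean at most `cost 2 γ ^ (1/2)` by Jensen. The resulting factor `N` is harmless, as only continuity
for fixed `N` is wanted. -/
lemma abs_average_sub_le {G : V × (Fin N → Rd d) → ℝ} {K : ℝ≥0} (hG : LipschitzWith K G)
    (v w : V) (μ ν : P2 d) :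
    |average G v μ - average G w ν| ≤ K * ‖v - w‖ + K * N * wassersteinDist 2 μ ν := by
  refine abs_le_of_forall_isCoupling one_le_two le_rfl (by positivity) (by positivity)
    fun γ hγ => (enorm_average_sub_le hG v w hγ).trans ?_
  have := hγ.isProbabilityMeasure
  have hb : ∀ p : Fin N → Rd d × Rd d, ‖G (v, fun i => (p i).1) - G (w, fun i => (p i).2)‖ₑ ≤
      K * (‖v - w‖ₑ + ∑ i, ‖(p i).1 - (p i).2‖ₑ) := fun p => by
    rw [← edist_eq_enorm_sub]
    refine (hG _ _).trans ?_
    gcongr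
    rw [Prod.edist_eq]
    refine max_le ((edist_eq_enorm_sub v w).le.trans le_self_add) ?_
    refine le_trans ?_ le_add_self
    refine edist_pi_le_iff.2 fun i => ?_
    rw [edist_eq_enorm_sub]
    exact Finset.single_le_sum (f := fun i => ‖(p i).1 - (p i).2‖ₑ) (fun _ _ => zero_le)
      (Finset.mem_univ i)
  have h1 : ∫⁻ p : Rd d × Rd d, ‖p.1 - p.2‖ₑ ∂γ ≤ cost 2 γ ^ (1 / 2 : ℝ) := by
    have := lintegral_rpow_inv_le (P := γ) one_le_two
      (f := fun p : Rd d × Rd d => ‖p.1 - p.2‖ₑ ^ (2 : ℝ)) (by fun_prop)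
    have hsq : ∀ t : ℝ≥0∞, (t ^ (2 : ℝ)) ^ (1 / 2 : ℝ) = t := fun t => by
      rw [← ENNReal.rpow_mul]; norm_num
    simp only [hsq] at this
    exact this
  calc _ ≤ ∫⁻ p, K * (‖v - w‖ₑ + ∑ i, ‖(p i).1 - (p i).2‖ₑ) ∂(Measure.pi fun _ : Fin N => γ) :=
        lintegral_mono hb
    _ = K * (‖v - w‖ₑ + ∑ i : Fin N, ∫⁻ p, ‖p.1 - p.2‖ₑ ∂γ) := by
        rw [lintegral_const_mul _ (by fun_prop), lintegral_add_left measurable_const,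
          lintegral_finsetSum _ (fun i _ => by fun_prop)]
        simp only [lintegral_const, measure_univ, mul_one]
        congr 3 with i
        exact lintegral_pi_eval (f := fun p : Rd d × Rd d => ‖p.1 - p.2‖ₑ) (by fun_prop) i
    _ ≤ K * (‖v - w‖ₑ + ∑ _i : Fin N, cost 2 γ ^ (1 / 2 : ℝ)) := by gcongr
    _ = _ := by
        rw [ENNReal.ofReal_mul (by positivity), ENNReal.ofReal_mul (by positivity), ofReal_norm]
        simp
        ring

lemma jointlyContinuous_average {m : ℕ} {G : (Fin m → Rd d) × (Fin N → Rd d) → ℝ} {K : ℝ≥0}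
    (hG : LipschitzWith K G) : JointlyContinuous (average G) := by
  intro v μ ε hε
  refine ⟨ε / (K + K * N + 1), by positivity, fun w ν hw hν => ?_⟩
  refine (abs_average_sub_le hG w v ν μ).trans_lt ?_
  rw [← dist_eq_norm]
  calc _ ≤ K * (ε / (K + K * N + 1)) + K * N * (ε / (K + K * N + 1)) := by gcongr
    _ = ε * ((K + K * N) / (K + K * N + 1)) := by ring
    _ < ε * 1 := by
        gcongr
        rw [div_lt_one (by positivity)]
        linarith
    _ = ε := mul_one _

variable [NormedSpace ℝ V] {G : V × (Fin N → Rd d) → ℝ}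

lemma integrable_fderiv_pi (hG : BoundedDerivs G) (v : V) (μ : P2 d) :
    Integrable (fun x => fderiv ℝ G (v, x)) (Measure.pi fun _ : Fin N => μ.1) := by
  obtain ⟨K, hK⟩ := hG.fderiv.exists_lipschitzWith
  exact integrable_pi_of_lipschitzWith hK v μ

/-- The derivative of `average G` in its first variable. -/
def averageDeriv (G : V × (Fin N → Rd d) → ℝ) (v : V) (μ : P2 d) : V →L[ℝ] ℝ :=
  (∫ x, fderiv ℝ G (v, x) ∂(Measure.pi fun _ : Fin N => μ.1)) ∘L ContinuousLinearMap.inl ℝ V _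

lemma averageDeriv_apply (hG : BoundedDerivs G) (v e : V) (μ : P2 d) :
    averageDeriv G v μ e = average (fun p => fderiv ℝ G p (e, 0)) v μ := by
  rw [averageDeriv, ContinuousLinearMap.comp_apply,
    ContinuousLinearMap.integral_apply (integrable_fderiv_pi hG v μ)]
  rfl

lemma hasFDerivAt_average (hG : BoundedDerivs G) (v : V) (μ : P2 d) :
    HasFDerivAt (fun v => average G v μ) (averageDeriv G v μ) v := by
  obtain ⟨K, hK⟩ := hG.exists_norm_fderiv_le
  obtain ⟨L, hL⟩ := hG.exists_lipschitzWith
  have hcomp : averageDeriv G v μ = ∫ x, fderiv ℝ G (v, x) ∘L ContinuousLinearMap.inl ℝ V _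
      ∂(Measure.pi fun _ : Fin N => μ.1) :=
    (((ContinuousLinearMap.compL ℝ V (V × (Fin N → Rd d)) ℝ).flip
      (ContinuousLinearMap.inl ℝ V _)).integral_comp_comm (integrable_fderiv_pi hG v μ)).symm
  rw [hcomp]
  refine hasFDerivAt_integral_of_dominated_of_fderiv_le (s := univ)
    (bound := fun _ => K * ‖ContinuousLinearMap.inl ℝ V (Fin N → Rd d)‖)
    (F' := fun v x => fderiv ℝ G (v, x) ∘L ContinuousLinearMap.inl ℝ V _) univ_mem
    (Eventually.of_forall fun w => (integrable_pi_of_lipschitzWith hL w μ).aestronglyMeasurable)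
    (integrable_pi_of_lipschitzWith hL v μ) ?_
    (Eventually.of_forall fun x w _ => ?_) (integrable_const _)
    (Eventually.of_forall fun x w _ => ?_)
  · have h := hG.fderiv.1.continuous
    exact Continuous.aestronglyMeasurable (by fun_prop)
  · refine (ContinuousLinearMap.opNorm_comp_le _ _).trans ?_
    gcongr
    exact hK _
  · exact (hG.hasFDerivAt (w, x)).comp w (hasFDerivAt_prodMk_left w x)

lemma toDual_symm_coord (l : Rd d →L[ℝ] ℝ) (j : Fin d) :
    (InnerProductSpace.toDual ℝ (Rd d)).symm l j = l (EuclideanSpace.single j 1) := by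
  rw [← InnerProductSpace.toDual_symm_apply (x := EuclideanSpace.single j 1) (y := l),
    EuclideanSpace.inner_single_right]
  simp

/-- The differential at `(v, x₁, …, y, …, x_N)`, with `y` in place of `x_i`, in the direction of
`x_i`, averaged over `x`. -/
def insertDeriv (G : V × (Fin N → Rd d) → ℝ) (v : V) (μ : P2 d) (i : Fin N) (y : Rd d) :
    Rd d →L[ℝ] ℝ :=
  (∫ x, fderiv ℝ G (v, Function.update x i y) ∂(Measure.pi fun _ : Fin N => μ.1)) ∘L
    (ContinuousLinearMap.inr ℝ V (Fin N → Rd d) ∘L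
      ContinuousLinearMap.single ℝ (fun _ => Rd d) i)

lemma integrable_fderiv_update (hG : BoundedDerivs G) (v : V) (P : Measure (Fin N → Rd d))
    [IsFiniteMeasure P] (i : Fin N) (y : Rd d) :
    Integrable (fun x => fderiv ℝ G (v, Function.update x i y)) P := by
  obtain ⟨K, hK⟩ := hG.exists_norm_fderiv_le
  have h := hG.fderiv.1.continuous
  refine Integrable.of_bound (C := K) (Continuous.aestronglyMeasurable (by fun_prop))
    (Eventually.of_forall fun x => hK _)

lemma insertDeriv_apply (hG : BoundedDerivs G) (v : V) (μ : P2 d) (i : Fin N) (y e : Rd d) :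
    insertDeriv G v μ i y e = ∫ x, fderiv ℝ G (v, Function.update x i y) (0, Pi.single i e)
      ∂(Measure.pi fun _ : Fin N => μ.1) := by
  rw [insertDeriv, ContinuousLinearMap.comp_apply,
    ContinuousLinearMap.integral_apply (integrable_fderiv_update hG v _ i y)]
  rfl

lemma continuous_insertDeriv (hG : BoundedDerivs G) (v : V) (μ : P2 d) (i : Fin N) :
    Continuous (insertDeriv G v μ i) := by
  obtain ⟨K, hK⟩ := hG.exists_norm_fderiv_le
  have h := hG.fderiv.1.continuous
  refine Continuous.clm_comp ?_ continuous_const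
  refine continuous_of_dominated (bound := fun _ => (K : ℝ))
    (fun y => (integrable_fderiv_update hG v _ i y).aestronglyMeasurable)
    (fun y => Eventually.of_forall fun x => hK _) (integrable_const _)
    (Eventually.of_forall fun x => by fun_prop)

lemma exists_norm_insertDeriv_le (hG : BoundedDerivs G) (v : V) (μ : P2 d) (i : Fin N) :
    ∃ C, ∀ y, ‖insertDeriv G v μ i y‖ ≤ C := by
  obtain ⟨K, hK⟩ := hG.exists_norm_fderiv_le
  refine ⟨K * ‖ContinuousLinearMap.inr ℝ V (Fin N → Rd d) ∘L
      ContinuousLinearMap.single ℝ (fun _ => Rd d) i‖, fun y => ?_⟩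
  refine (ContinuousLinearMap.opNorm_comp_le _ _).trans ?_
  gcongr
  refine (norm_integral_le_of_norm_le_const (C := (K : ℝ))
    (Eventually.of_forall fun x => hK _)).trans ?_
  simp

/-- The Lions derivative of `average G v` at `μ`. -/
def lionsDeriv (G : V × (Fin N → Rd d) → ℝ) (v : V) (μ : P2 d) (y : Rd d) : Rd d :=
  (InnerProductSpace.toDual ℝ (Rd d)).symm (∑ i, insertDeriv G v μ i y)

/-- Resampling one coordinate independently does not change a product law. This isolates the
variable `y` of the Lions derivative without splitting the product. -/
lemma measurePreserving_update {α : Type} [MeasurableSpace α] (P : Measure α)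
    [IsProbabilityMeasure P] (i : Fin N) :
    MeasurePreserving (fun p : α × (Fin N → α) => Function.update p.2 i p.1)
      (P.prod (Measure.pi fun _ => P)) (Measure.pi fun _ => P) := by
  have hm : Measurable fun p : α × (Fin N → α) => Function.update p.2 i p.1 := by
    refine measurable_pi_lambda _ fun j => ?_
    by_cases h : j = i
    · subst h; simpa using measurable_fst
    · simp only [Function.update_of_ne h]; fun_prop
  refine ⟨hm, (Measure.pi_eq fun s hs => ?_).symm⟩
  rw [Measure.map_apply hm (MeasurableSet.univ_pi hs)]
  have hpre : (fun p : α × (Fin N → α) => Function.update p.2 i p.1) ⁻¹' (univ.pi s) =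
      s i ×ˢ univ.pi (Function.update s i univ) := by
    ext p
    simp only [mem_preimage, Set.mem_pi, mem_univ, true_imp_iff, mem_prod]
    constructor
    · intro h
      refine ⟨by simpa using h i, fun j => ?_⟩
      by_cases hj : j = i
      · subst hj; simp
      · have := h j
        rw [Function.update_of_ne hj] at this ⊢
        exact this
    · rintro ⟨h1, h2⟩ j
      by_cases hj : j = i
      · subst hj; simpa using h1
      · have := h2 j
        rw [Function.update_of_ne hj] at this ⊢
        exact this
  rw [hpre, Measure.prod_prod, Measure.pi_pi, ← Finset.mul_prod_erase _ _ (Finset.mem_univ i),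
    ← Finset.mul_prod_erase (Finset.univ) (fun j => P (s j)) (Finset.mem_univ i)]
  simp only [Function.update_self, measure_univ, one_mul]
  congr 1
  refine Finset.prod_congr rfl fun j hj => ?_
  rw [Function.update_of_ne (Finset.ne_of_mem_erase hj)]

lemma integrable_fderiv_sample (hG : BoundedDerivs G) (v : V) (X Y : E d) (i : Fin N) :
    Integrable (fun ω : Fin N → ℝ =>
      fderiv ℝ G (v, fun j => X (ω j)) (0, Pi.single i (Y (ω i)))) (cubeMeasure N) := by
  have hc := hG.fderiv.1.continuous
  obtain ⟨K, hK⟩ := hG.exists_norm_fderiv_le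
  have hY : Integrable (fun ω : Fin N → ℝ => Y (ω i)) (cubeMeasure N) :=
    integrable_comp_eval (μ := fun _ => unitMeasure) ((Lp.memLp Y).integrable (by norm_num))
  have hD : MemLp (fun ω : Fin N → ℝ => fderiv ℝ G (v, fun j => X (ω j))) ∞ (cubeMeasure N) := by
    refine MemLp.of_bound ?_ K (Eventually.of_forall fun ω => hK _)
    exact (hc.comp (Continuous.prodMk_right v)).comp_aestronglyMeasurable
      (aemeasurable_sample X).aestronglyMeasurable
  exact memLp_one_iff_integrable.1
    (((ContinuousLinearMap.compL ℝ (Rd d) (V × (Fin N → Rd d)) ℝ).flip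
      (ContinuousLinearMap.inr ℝ V (Fin N → Rd d) ∘L
        -- Hölder with exponents `∞` and `1`: `DG` is bounded and `Y (ω i)` is integrable.
        ContinuousLinearMap.single ℝ (fun _ => Rd d) i)).memLp_of_bilin (p := ∞) (q := 1) 1 hD
      (memLp_one_iff_integrable.2 hY))

/-- Condition on `ω i = s`: after resampling coordinate `i`, Fubini leaves the average defining
`insertDeriv` at the point `X s`. -/
lemma integral_insertDeriv (hG : BoundedDerivs G) (v : V) (X Y : E d) (i : Fin N) :
    ∫ s, insertDeriv G v (law X) i (X s) (Y s) ∂unitMeasure =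
      ∫ ω, fderiv ℝ G (v, fun j => X (ω j)) (0, Pi.single i (Y (ω i))) ∂(cubeMeasure N) := by
  have hc := hG.fderiv.1.continuous
  have hint := integrable_fderiv_sample hG v X Y i
  have hmp := measurePreserving_update unitMeasure i
  have hmap := hmp.map_eq
  have hint' := hmp.integrable_comp_of_integrable hint
  simp only [Function.comp_def] at hint'
  rw [cubeMeasure, ← hmap, integral_map hmp.measurable.aemeasurable
    (by rw [hmap]; exact hint.aestronglyMeasurable), integral_prod _ hint']
  refine integral_congr_ae (Eventually.of_forall fun s => ?_)
  simp only [Function.update_self]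
  rw [insertDeriv_apply hG, pi_map_law, integral_map (aemeasurable_sample X)]
  · refine integral_congr_ae (Eventually.of_forall fun ω => ?_)
    have : (fun j => X (Function.update ω i s j)) = Function.update (fun j => X (ω j)) i (X s) := by
      ext1 j
      by_cases hj : j = i
      · subst hj; simp
      · simp [Function.update_of_ne hj]
    simp only [this]
  · exact Continuous.aestronglyMeasurable (by fun_prop)

/-- In the direction `Y`, the derivative of the lift is the sum over `i` of the means of `∂_{x_i} G`
applied to `Y (ω i)`. By `integral_insertDeriv` each mean is a single integral over `(0,1)`, so the
sum is an inner product in `E`. Boundedness of `insertDeriv` places the gradient in `L²`. -/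
lemma hasLDerivAt_average (hG : BoundedDerivs G) (v : V) (μ : P2 d) :
    HasLDerivAt (average G v) (lionsDeriv G v μ) μ := by
  rintro X rfl
  have hcont : Continuous (lionsDeriv G v (law X)) :=
    (InnerProductSpace.toDual ℝ (Rd d)).symm.continuous.comp
      (continuous_finsetSum _ fun i _ => continuous_insertDeriv hG v (law X) i)
  choose C hC using exists_norm_insertDeriv_le hG v (law X)
  have hmem : MemLp (fun ω => lionsDeriv G v (law X) (X ω)) 2 unitMeasure :=
    MemLp.of_bound (hcont.comp_aestronglyMeasurable (Lp.aestronglyMeasurable X)) (∑ i, C i)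
      (Eventually.of_forall fun ω => by
        rw [lionsDeriv, LinearIsometryEquiv.norm_map]
        exact norm_sum_le_of_le _ fun i _ => hC i _)
  refine ⟨hmem.toLp _, ?_, hmem.coeFn_toLp⟩
  have hder := (hasFDerivAt_lift_average hG (v, X)).comp X (hasFDerivAt_prodMk_right v X)
  rw [hasGradientAt_iff_hasFDerivAt]
  suffices h : InnerProductSpace.toDual ℝ (E d) (hmem.toLp _) =
      (integralDeriv hG (sample V d N (v, X)) ∘L sample V d N) ∘L
        ContinuousLinearMap.inr ℝ V (E d) by
    rw [h]; exact hder
  ext1 Y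
  rw [InnerProductSpace.toDual_apply_apply, L2.inner_def]
  have hins : ∀ i, Integrable (fun s => insertDeriv G v (law X) i (X s) (Y s)) unitMeasure :=
    fun i => by
      have hm : MemLp (fun s => insertDeriv G v (law X) i (X s)) 2 unitMeasure :=
        MemLp.of_bound ((continuous_insertDeriv hG v (law X) i).comp_aestronglyMeasurable
          (Lp.aestronglyMeasurable X)) (C i) (Eventually.of_forall fun s => hC i _)
      exact memLp_one_iff_integrable.1
        ((ContinuousLinearMap.id ℝ (Rd d →L[ℝ] ℝ)).memLp_of_bilin (p := 2) (q := 2) 1 hm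
          (Lp.memLp Y))
  have e1 : ∫ s, inner ℝ (hmem.toLp _ s) (Y s) ∂unitMeasure =
      ∑ i, ∫ s, insertDeriv G v (law X) i (X s) (Y s) ∂unitMeasure := by
    rw [← integral_finsetSum _ fun i _ => hins i]
    refine integral_congr_ae ?_
    filter_upwards [hmem.coeFn_toLp] with s hs
    rw [hs, lionsDeriv, InnerProductSpace.toDual_symm_apply]
    simp
  rw [e1]
  simp only [integral_insertDeriv hG]
  rw [← integral_finsetSum _ fun i _ => integrable_fderiv_sample hG v X Y i]
  simp only [ContinuousLinearMap.comp_apply, ContinuousLinearMap.inr_apply, integralDeriv_apply]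
  refine integral_congr_ae ?_
  filter_upwards [coeFn_sample (N := N) v X, coeFn_sample (N := N) (0 : V) Y] with ω h1 h2
  rw [h1, h2, ← map_sum]
  congr 1
  ext : 1
  · simp [Prod.fst_sum]
  · simp only [Prod.snd_sum]
    exact Finset.univ_sum_single _

/-- The linear map `((v, y), x) ↦ (v, x₁, …, y, …, x_N)`, with `y` in place of `x_i`. -/
def insertMap (d m N : ℕ) (i : Fin N) :
    (Fin (m + 1) → Rd d) × (Fin N → Rd d) →L[ℝ] (Fin m → Rd d) × (Fin N → Rd d) :=
  ContinuousLinearMap.prod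
    (ContinuousLinearMap.pi fun k =>
      ContinuousLinearMap.proj k.castSucc ∘L ContinuousLinearMap.fst ℝ _ _)
    (ContinuousLinearMap.pi fun k =>
      if k = i then ContinuousLinearMap.proj (Fin.last m) ∘L ContinuousLinearMap.fst ℝ _ _
      else ContinuousLinearMap.proj k ∘L ContinuousLinearMap.snd ℝ _ _)

lemma insertMap_apply {m : ℕ} (i : Fin N) (w : Fin (m + 1) → Rd d) (x : Fin N → Rd d) :
    insertMap d m N i (w, x) =
      (fun k => w k.castSucc, Function.update x i (w (Fin.last m))) := by
  ext1
  · rfl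
  · ext1 k
    by_cases hk : k = i
    · subst hk; simp [insertMap]
    · simp [insertMap, hk]

/-- This closes the induction: with `y` counted among the free variables, the Lions derivative is an
average of derivatives of `G` precomposed with linear maps. -/
lemma lionsDeriv_coord {m : ℕ} {G : (Fin m → Rd d) × (Fin N → Rd d) → ℝ} (hG : BoundedDerivs G)
    (w : Fin (m + 1) → Rd d) (μ : P2 d) (j : Fin d) :
    lionsDeriv G (fun k => w k.castSucc) μ (w (Fin.last m)) j =
      average (fun p => ∑ i, fderiv ℝ G (insertMap d m N i p)
        (0, Pi.single i (EuclideanSpace.single j 1))) w μ := by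
  rw [lionsDeriv, toDual_symm_coord, _root_.sum_apply, average]
  simp only [insertMap_apply, insertDeriv_apply hG]
  rw [integral_finsetSum _ fun i _ => ?_]
  exact (integrable_fderiv_update hG _ _ i _).apply_continuousLinearMap _

lemma isCk_average (k : ℕ) {m : ℕ} {G : (Fin m → Rd d) × (Fin N → Rd d) → ℝ}
    (hG : BoundedDerivs G) : IsCk k m (average G) := by
  -- Each Lions derivative adds a free variable, so `m` must vary.
  induction k generalizing m with
  | zero =>
    obtain ⟨K, hK⟩ := hG.exists_lipschitzWith
    exact jointlyContinuous_average hK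
  | succ k ih =>
    obtain ⟨K, hK⟩ := hG.exists_lipschitzWith
    refine ⟨jointlyContinuous_average hK, contDiff_one_lift_average hG,
      ⟨fun i v μ => (InnerProductSpace.toDual ℝ (Rd d)).symm
        (averageDeriv G v μ ∘L ContinuousLinearMap.single ℝ (fun _ => Rd d) i),
        fun i v μ => ?_, fun i j => ?_⟩,
      ⟨lionsDeriv G, fun v μ => hasLDerivAt_average hG v μ, fun j => ?_⟩⟩
    · rw [hasGradientAt_iff_hasFDerivAt, LinearIsometryEquiv.apply_symm_apply]
      -- The chain rule through `Function.update v i` needs the base point in the form `update v i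
      -- (v i)`.
      have h := hasFDerivAt_average hG (Function.update v i (v i)) μ
      rw [Function.update_eq_self] at h
      have h' := h
      nth_rewrite 2 [← Function.update_eq_self i v] at h'
      have hu : HasFDerivAt (Function.update v i)
          (ContinuousLinearMap.single ℝ (fun _ => Rd d) i) (v i) := by
        have hs : ContinuousLinearMap.single ℝ (fun _ => Rd d) i =
            ContinuousLinearMap.pi (Pi.single i (ContinuousLinearMap.id ℝ (Rd d))) := by
          refine ContinuousLinearMap.ext fun e => funext fun j => ?_
          by_cases hj : j = i
          · subst hj; simp
          · simp [hj]
        rw [hs]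
        exact hasFDerivAt_update v (v i)
      exact h'.comp (v i) hu
    · have he : (fun v μ => (InnerProductSpace.toDual ℝ (Rd d)).symm
          (averageDeriv G v μ ∘L ContinuousLinearMap.single ℝ (fun _ => Rd d) i) j) =
          average fun p => fderiv ℝ G p (Pi.single i (EuclideanSpace.single j 1), 0) := by
        ext v μ
        rw [toDual_symm_coord]
        exact averageDeriv_apply hG v _ μ
      rw [he]
      exact ih (hG.fderiv_apply _)
    · have he : (fun (w : Fin (m + 1) → Rd d) μ =>
          lionsDeriv G (fun i => w i.castSucc) μ (w (Fin.last m)) j) = average (fun p =>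
            ∑ i, fderiv ℝ G (insertMap d m N i p)
              (0, Pi.single i (EuclideanSpace.single j 1))) := by
        ext w μ
        exact lionsDeriv_coord hG w μ j
      rw [he]
      exact ih (BoundedDerivs.sum fun i _ => (hG.fderiv_apply _).comp_clm (insertMap d m N i))

end AverageDerivatives

/-! ### The approximations: regularity, Lipschitz bound, convexity -/

/-- The linear map `(x₀, (x₁, …, x_N)) ↦ (x₀, x₁, …, x_N)`. -/
def consMap (d N : ℕ) : Rd d × (Fin N → Rd d) →L[ℝ] (Fin (N + 1) → Rd d) :=
  ContinuousLinearMap.pi fun j => Fin.cases (ContinuousLinearMap.fst ℝ _ _)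
    (fun i => ContinuousLinearMap.proj i ∘L ContinuousLinearMap.snd ℝ _ _) j

lemma consMap_apply {d N : ℕ} (p : Rd d × (Fin N → Rd d)) :
    consMap d N p = Fin.cons p.1 p.2 := by
  ext1 j
  refine Fin.cases ?_ (fun i => ?_) j <;> simp [consMap]

lemma approx_eq_average {d : ℕ} (φ : Rd d → P2 d → ℝ) (N : ℕ) [NeZero N] (ε : ℝ) :
    approx φ N ε = average fun p => mollifyAll φ N ε (consMap d N p) := by
  ext x μ
  simp only [approx, average, mollify_eq_mollifyAll, consMap_apply]

section Lipschitz

variable {d N : ℕ} [NeZero N] {r C ε : ℝ} {φ : Rd d → P2 d → ℝ}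

lemma IsLipschitzWith.isC11_lift_approx (hr : 1 ≤ r) (hC : 0 ≤ C) (hε : 0 < ε)
    (h : IsLipschitzWith r C φ) : IsC11 (lift (approx φ N ε)) := by
  rw [approx_eq_average]
  exact isC11_lift_average ((h.boundedDerivs_mollifyAll hr hC hε).comp_clm (consMap d N))

lemma IsLipschitzWith.isSmooth_approx (hr : 1 ≤ r) (hC : 0 ≤ C) (hε : 0 < ε)
    (h : IsLipschitzWith r C φ) : IsSmooth (approx φ N ε) := fun k => by
  rw [approx_eq_average]
  exact isCk_average k ((h.boundedDerivs_mollifyAll hr hC hε).comp_clm (consMap d N ∘L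
    (ContinuousLinearMap.proj (R := ℝ) (φ := fun _ : Fin 1 => Rd d) 0).prodMap
      (ContinuousLinearMap.id ℝ (Fin N → Rd d))))

/-- Shifting both arguments by the same `y` leaves all differences unchanged, and the mollifier has
mass one. Keeping the power mean instead of the sup norm is what preserves the constant `C`. -/
lemma IsLipschitzWith.enorm_mollifyAll_sub_le (hr : 1 ≤ r) (hC : 0 ≤ C) (hε : 0 < ε)
    (h : IsLipschitzWith r C φ) (z w : Fin (N + 1) → Rd d) :
    ‖mollifyAll φ N ε z - mollifyAll φ N ε w‖ₑ ≤ ENNReal.ofReal C * (‖z 0 - w 0‖ₑ +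
      ((N : ℝ≥0∞)⁻¹ * ∑ i : Fin N, ‖z i.succ - w i.succ‖ₑ ^ r) ^ (1 / r)) := by
  rw [mollifyAll, mollifyAll, ← integral_sub (h.integrable_mollifyAll_integrand hr hC hε z)
    (h.integrable_mollifyAll_integrand hr hC hε w)]
  refine (enorm_integral_le_lintegral_enorm _).trans ?_
  set B := ENNReal.ofReal C * (‖z 0 - w 0‖ₑ +
    ((N : ℝ≥0∞)⁻¹ * ∑ i : Fin N, ‖z i.succ - w i.succ‖ₑ ^ r) ^ (1 / r))
  calc _ ≤ ∫⁻ y : Fin (N + 1) → Rd d, ENNReal.ofReal (prodMollifier ε y) * B := by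
        refine lintegral_mono fun y => ?_
        rw [← mul_sub, enorm_mul, Real.enorm_of_nonneg (prodMollifier_nonneg hε y)]
        gcongr
        refine (h.enorm_sub_empirical_le hC _ _ _ _).trans_eq ?_
        simp [B]
    _ = B := by
        rw [lintegral_mul_const _ (contDiff_prodMollifier ε).continuous.measurable.ennreal_ofReal,
          lintegral_prodMollifier hε, one_mul]

/-- Draw both samples from `γ^{⊗N}` and apply Jensen: the mean of the `N` pairwise costs is the cost
of `γ`, so neither `N` nor `ε` enters the constant. -/
lemma IsLipschitzWith.approx (hr : 1 ≤ r) (hr₂ : r ≤ 2) (hC : 0 ≤ C) (hε : 0 < ε)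
    (h : IsLipschitzWith r C φ) : IsLipschitzWith r C (approx φ N ε) := by
  refine isLipschitzWith_of_enorm_sub_le hr hr₂ hC fun x y μ β γ hγ => ?_
  have := hγ.isProbabilityMeasure
  obtain ⟨K, hK⟩ :=
    ((h.boundedDerivs_mollifyAll (N := N) hr hC hε).comp_clm (consMap d N)).exists_lipschitzWith
  rw [approx_eq_average]
  have hm : Measurable fun p : Fin N → Rd d × Rd d =>
      (N : ℝ≥0∞)⁻¹ * ∑ i, ‖(p i).1 - (p i).2‖ₑ ^ r := by fun_prop
  calc _ ≤ _ := enorm_average_sub_le hK x y hγ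
    _ ≤ ∫⁻ p, ENNReal.ofReal C * (‖x - y‖ₑ +
          ((N : ℝ≥0∞)⁻¹ * ∑ i, ‖(p i).1 - (p i).2‖ₑ ^ r) ^ (1 / r))
          ∂(Measure.pi fun _ : Fin N => γ) := by
        refine lintegral_mono fun p => ?_
        refine (h.enorm_mollifyAll_sub_le hr hC hε _ _).trans_eq ?_
        simp [consMap_apply]
    _ = ENNReal.ofReal C * (‖x - y‖ₑ + ∫⁻ p,
          ((N : ℝ≥0∞)⁻¹ * ∑ i, ‖(p i).1 - (p i).2‖ₑ ^ r) ^ (1 / r)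
          ∂(Measure.pi fun _ : Fin N => γ)) := by
        rw [lintegral_const_mul _ (by fun_prop), lintegral_add_left measurable_const]
        simp
    _ ≤ ENNReal.ofReal C * (‖x - y‖ₑ + (∫⁻ p,
          ((N : ℝ≥0∞)⁻¹ * ∑ i, ‖(p i).1 - (p i).2‖ₑ ^ r)
          ∂(Measure.pi fun _ : Fin N => γ)) ^ (1 / r)) := by
        gcongr
        exact lintegral_rpow_inv_le hr hm.aemeasurable
    _ = _ := by
        rw [lintegral_const_mul _ (by fun_prop), lintegral_finsetSum _ (fun i _ => by fun_prop)]
        have hi : ∀ i : Fin N, ∫⁻ p, ‖(p i).1 - (p i).2‖ₑ ^ r ∂(Measure.pi fun _ : Fin N => γ) =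
            cost r γ := fun i =>
          lintegral_pi_eval (f := fun p : Rd d × Rd d => ‖p.1 - p.2‖ₑ ^ r) (by fun_prop) i
        simp only [hi]
        rw [inv_mul_sum_const]

end Lipschitz

lemma convexOn_lift_average {d N : ℕ} {V : Type} [NormedAddCommGroup V] [NormedSpace ℝ V]
    {G : V × (Fin N → Rd d) → ℝ} {K : ℝ≥0} (hK : LipschitzWith K G) (hG : ConvexOn ℝ univ G) :
    ConvexOn ℝ univ (lift (average G)) := by
  refine ⟨convex_univ, fun p _ q _ a b ha hb hab => ?_⟩
  have hint : ∀ U : Lp (V × (Fin N → Rd d)) 2 (cubeMeasure N),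
      Integrable (fun ω => G (U ω)) (cubeMeasure N) := fun U =>
    integrable_comp_of_lipschitzWith hK ((Lp.memLp U).integrable (by norm_num))
  have he : ∀ p, lift (average G) p = ∫ ω, G (sample V d N p ω) ∂(cubeMeasure N) := fun p =>
    average_law hK.continuous p.1 p.2
  rw [he, he, he, smul_eq_mul, smul_eq_mul, ← integral_const_mul, ← integral_const_mul,
    ← integral_add ((hint _).const_mul a) ((hint _).const_mul b)]
  refine integral_mono_ae (hint _) (((hint _).const_mul a).add ((hint _).const_mul b)) ?_
  rw [map_add, map_smul, map_smul]
  filter_upwards [Lp.coeFn_add (a • sample V d N p) (b • sample V d N q),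
    Lp.coeFn_smul a (sample V d N p), Lp.coeFn_smul b (sample V d N q)] with ω h1 h2 h3
  rw [h1, Pi.add_apply, h2, h3]
  exact hG.2 (mem_univ _) (mem_univ _) ha hb hab

/-! ### Empirical measures as laws of step functions; convexity. -/

section Convexity

variable {d N : ℕ} [NeZero N]

/-- The index of the interval of length `1/N` that contains `s ∈ [0,1)`. -/
def cellIndex (N : ℕ) [NeZero N] (s : ℝ) : Fin N := Fin.ofNat N ⌊N * s⌋₊

lemma measurable_cellIndex : Measurable (cellIndex N) := by
  have h : Measurable (Fin.ofNat N) := measurable_from_top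
  exact h.comp (Nat.measurable_floor.comp (measurable_const_mul _))

lemma map_cellIndex :
    unitMeasure.map (cellIndex N) = (N : ℝ≥0∞)⁻¹ • ∑ i, Measure.dirac i := by
  have hN : (0 : ℝ) < N := by exact_mod_cast Nat.pos_of_ne_zero (NeZero.ne N)
  refine Measure.ext_of_singleton fun i => ?_
  rw [Measure.map_apply measurable_cellIndex (measurableSet_singleton i), unitMeasure,
    Measure.restrict_congr_set Ioo_ae_eq_Ico,
    Measure.restrict_apply (measurable_cellIndex (measurableSet_singleton i))]
  have hset : cellIndex N ⁻¹' {i} ∩ Ico (0 : ℝ) 1 = Ico ((i : ℝ) / N) ((i + 1 : ℝ) / N) := by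
    ext s
    simp only [mem_inter_iff, mem_preimage, mem_singleton_iff, mem_Ico, div_le_iff₀ hN,
      lt_div_iff₀ hN]
    -- `Fin.ofNat` reduces modulo `N`, which does nothing here since the floor is below `N` on
    -- `[0,1)`.
    have key : 0 ≤ s → s < 1 → (cellIndex N s = i ↔ (i : ℝ) ≤ s * N ∧ s * N < i + 1) := by
      intro h0 h1
      have hlt : ⌊N * s⌋₊ < N := by
        rw [Nat.floor_lt (by positivity)]
        nlinarith
      rw [cellIndex, Fin.ext_iff, Fin.val_ofNat, Nat.mod_eq_of_lt hlt,
        Nat.floor_eq_iff (by positivity), mul_comm]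
    constructor
    · rintro ⟨h, h0, h1⟩
      exact (key h0 h1).1 h
    · intro h
      have hi : ((i : ℕ) : ℝ) + 1 ≤ N := by exact_mod_cast i.2
      have h0 : 0 ≤ s := by
        by_contra hs
        have : (0 : ℝ) ≤ (i : ℕ) := by positivity
        nlinarith [h.1]
      have h1 : s < 1 := by
        by_contra hs
        nlinarith [h.2]
      exact ⟨(key h0 h1).2 h, h0, h1⟩
  rw [hset, Real.volume_Ico, ← sub_div, add_sub_cancel_left, one_div,
    ENNReal.ofReal_inv_of_pos hN, ENNReal.ofReal_natCast]
  simp [Set.indicator_apply]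

lemma memLp_step (z : Fin N → Rd d) : MemLp (fun s => z (cellIndex N s)) 2 unitMeasure := by
  have h : Measurable z := measurable_of_finite z
  exact MemLp.of_bound (h.comp measurable_cellIndex).aestronglyMeasurable ‖z‖
    (Eventually.of_forall fun s => norm_le_pi_norm z _)

/-- The step function with values `z₁, …, z_N` on intervals of length `1/N`. -/
def step (d N : ℕ) [NeZero N] : (Fin N → Rd d) →ₗ[ℝ] E d where
  toFun z := (memLp_step z).toLp _
  map_add' z w := MemLp.toLp_add (memLp_step z) (memLp_step w)
  map_smul' c z := MemLp.toLp_const_smul c (memLp_step z)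

lemma law_step (z : Fin N → Rd d) : law (step d N z) = empirical z := by
  have hz : Measurable z := measurable_of_finite z
  refine Subtype.ext ?_
  change unitMeasure.map (step d N z) = (N : ℝ≥0∞)⁻¹ • ∑ i, Measure.dirac (z i)
  have hs : step d N z =ᵐ[unitMeasure] fun s => z (cellIndex N s) := (memLp_step z).coeFn_toLp
  rw [Measure.map_congr hs]
  change unitMeasure.map (z ∘ cellIndex N) = _
  rw [← Measure.map_map hz measurable_cellIndex, map_cellIndex, Measure.map_smul,
    Measure.map_finset_sum hz.aemeasurable]
  simp only [Measure.map_dirac' hz]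

/-- By `law_step`, `onPoints` is the lift precomposed with a linear map: moving the points moves the
random variable linearly. -/
lemma convexOn_onPoints {φ : Rd d → P2 d → ℝ} (h : ConvexOn ℝ univ (lift φ)) :
    ConvexOn ℝ univ (onPoints φ N) := by
  have he : onPoints φ N = lift φ ∘ ((LinearMap.proj (R := ℝ) (φ := fun _ => Rd d) 0).prod
      (step d N ∘ₗ LinearMap.funLeft ℝ (Rd d) Fin.succ)) := by
    ext z
    simp only [onPoints, Function.comp_apply, lift, LinearMap.prod_apply, Function.prod_apply,
      LinearMap.comp_apply, law_step]
    rfl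
  rw [he]
  exact h.comp_linearMap _

variable {r C ε : ℝ} {φ : Rd d → P2 d → ℝ}

lemma convexOn_mollifyAll (hr : 1 ≤ r) (hC : 0 ≤ C) (hε : 0 < ε) (h : IsLipschitzWith r C φ)
    (hφ : ConvexOn ℝ univ (lift φ)) : ConvexOn ℝ univ (mollifyAll φ N ε) := by
  refine ⟨convex_univ, fun z _ w _ a b ha hb hab => ?_⟩
  have hz := h.integrable_mollifyAll_integrand hr hC hε z
  have hw := h.integrable_mollifyAll_integrand hr hC hε w
  simp only [mollifyAll, smul_eq_mul]
  rw [← integral_const_mul, ← integral_const_mul, ← integral_add (hz.const_mul a) (hw.const_mul b)]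
  refine integral_mono (h.integrable_mollifyAll_integrand hr hC hε _)
    ((hz.const_mul a).add (hw.const_mul b)) fun y => ?_
  have hy : a • z + b • w - y = a • (z - y) + b • (w - y) := by
    have : y = a • y + b • y := by rw [← add_smul, hab, one_smul]
    rw [smul_sub, smul_sub]
    nth_rewrite 1 [this]
    abel
  have hc := (convexOn_onPoints (N := N) hφ).2 (mem_univ (z - y)) (mem_univ (w - y)) ha hb hab
  have := mul_le_mul_of_nonneg_left hc (prodMollifier_nonneg hε y)
  rw [← hy] at this
  refine this.trans_eq ?_
  simp only [smul_eq_mul]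
  ring

lemma convexOn_lift_approx (hr : 1 ≤ r) (hC : 0 ≤ C) (hε : 0 < ε) (h : IsLipschitzWith r C φ)
    (hφ : ConvexOn ℝ univ (lift φ)) : ConvexOn ℝ univ (lift (approx φ N ε)) := by
  obtain ⟨K, hK⟩ :=
    ((h.boundedDerivs_mollifyAll (N := N) hr hC hε).comp_clm (consMap d N)).exists_lipschitzWith
  rw [approx_eq_average]
  exact convexOn_lift_average hK
    ((convexOn_mollifyAll hr hC hε h hφ).comp_linearMap (consMap d N).toLinearMap)

end Convexity

/-! ### Convergence -/

/-! ### Uniform discretization of measures, and transport on a finite set. -/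

section Discretization

variable {d : ℕ}

/-- A simple function that is `δ`-close to the identity on the ball of radius `L` and vanishes
outside of it. -/
lemma exists_simpleFunc_near_id (d : ℕ) {δ : ℝ} (hδ : 0 < δ) (L : ℝ) :
    ∃ f : SimpleFunc (Rd d) (Rd d), (∀ x, ‖x‖ ≤ L → ‖x - f x‖ ≤ δ) ∧ ∀ x, L < ‖x‖ → f x = 0 := by
  classical
  set e := TopologicalSpace.denseSeq (Rd d)
  obtain ⟨t, ht⟩ := (isCompact_closedBall (0 : Rd d) L).elim_finite_subcover
    (fun k => Metric.ball (e k) δ) (fun k => Metric.isOpen_ball) fun x _ => by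
      obtain ⟨k, hk⟩ := (TopologicalSpace.denseRange_denseSeq (Rd d)).exists_dist_lt x hδ
      exact mem_iUnion.2 ⟨k, hk⟩
  -- `t.sup id` is the largest index in the subcover, so `nearestPt` compares at least all of its
  -- centres.
  refine ⟨SimpleFunc.piecewise (Metric.closedBall 0 L) measurableSet_closedBall
    (SimpleFunc.nearestPt e (t.sup id)) (SimpleFunc.const _ 0), fun x hx => ?_, fun x hx => ?_⟩
  · have hx' : x ∈ Metric.closedBall (0 : Rd d) L := by simpa using hx
    obtain ⟨k, hk, hxk⟩ := mem_iUnion₂.1 (ht hx')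
    rw [SimpleFunc.piecewise_apply, if_pos hx']
    have h1 := SimpleFunc.edist_nearestPt_le e x (Finset.le_sup (f := id) hk)
    rw [edist_dist, edist_dist, ENNReal.ofReal_le_ofReal_iff dist_nonneg] at h1
    rw [← dist_eq_norm, dist_comm]
    refine h1.trans ?_
    rw [id, dist_comm]
    exact (Metric.mem_ball.1 hxk).le
  · have hx' : x ∉ Metric.closedBall (0 : Rd d) L := by simpa using hx
    rw [SimpleFunc.piecewise_apply, if_neg hx']
    rfl

/-- Measures with bounded second moments are uniformly approximated by their images under a simple
function, in the transport cost with exponent `r < 2`. -/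
lemma exists_simpleFunc_cost_le (d : ℕ) {r : ℝ} (hr₁ : 1 ≤ r) (hr₂ : r < 2) {R τ : ℝ}
    (hτ : 0 < τ) : ∃ f : SimpleFunc (Rd d) (Rd d), ∀ μ : P2 d,
      secondMoment μ.1 ≤ ENNReal.ofReal R →
      ∫⁻ x, ‖x - f x‖ₑ ^ r ∂μ.1 ≤ ENNReal.ofReal τ := by
  have hr0 : 0 < r := by linarith
  -- Beyond radius `L`, `|x|^r ≤ L^{r-2} |x|²`; the decay of this factor is where `r < 2` is needed.
  have hlim : Tendsto (fun L : ℝ => L ^ (-(2 - r)) * R) atTop (𝓝 0) := by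
    simpa using (tendsto_rpow_neg_atTop (sub_pos.2 hr₂)).mul_const R
  obtain ⟨L, hL, hL0⟩ := ((hlim.eventually_lt_const (half_pos hτ)).and
    (eventually_gt_atTop 0)).exists
  -- With this radius the ball contributes at most `δ^r = τ/2`, and the tail the other half.
  have hδ : 0 < (τ / 2) ^ (1 / r) := by positivity
  obtain ⟨f, hf₁, hf₂⟩ := exists_simpleFunc_near_id d hδ L
  refine ⟨f, fun μ hμ => ?_⟩
  have hpt : ∀ x, ‖x - f x‖ₑ ^ r ≤
      ENNReal.ofReal (τ / 2) + ENNReal.ofReal (L ^ (-(2 - r))) * ‖x‖ₑ ^ (2 : ℝ) := fun x => by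
    rcases le_or_gt ‖x‖ L with hx | hx
    · refine le_trans ?_ le_self_add
      rw [← ofReal_norm, ENNReal.ofReal_rpow_of_nonneg (norm_nonneg _) hr0.le]
      refine ENNReal.ofReal_le_ofReal
        ((Real.rpow_le_rpow (norm_nonneg _) (hf₁ x hx) hr0.le).trans ?_)
      rw [← Real.rpow_mul (by positivity), one_div_mul_cancel hr0.ne', Real.rpow_one]
    · refine le_trans ?_ le_add_self
      have hx0 : 0 < ‖x‖ := hL0.trans hx
      rw [hf₂ x hx, sub_zero, ← ofReal_norm, ENNReal.ofReal_rpow_of_nonneg (norm_nonneg _) hr0.le,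
        ENNReal.ofReal_rpow_of_nonneg (norm_nonneg _) (by norm_num),
        ← ENNReal.ofReal_mul (by positivity)]
      refine ENNReal.ofReal_le_ofReal ?_
      calc ‖x‖ ^ r = ‖x‖ ^ (-(2 - r)) * ‖x‖ ^ (2 : ℝ) := by
            rw [← Real.rpow_add hx0]; congr 1; ring
        _ ≤ _ := mul_le_mul_of_nonneg_right
            (Real.rpow_le_rpow_of_nonpos hL0 hx.le (by linarith)) (by positivity)
  calc _ ≤ ∫⁻ x, (ENNReal.ofReal (τ / 2) + ENNReal.ofReal (L ^ (-(2 - r))) * ‖x‖ₑ ^ (2 : ℝ)) ∂μ.1 :=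
        lintegral_mono hpt
    _ = ENNReal.ofReal (τ / 2) + ENNReal.ofReal (L ^ (-(2 - r))) * secondMoment μ.1 := by
        rw [lintegral_add_left measurable_const, lintegral_const_mul _ (by fun_prop)]
        simp [secondMoment]
    _ ≤ ENNReal.ofReal (τ / 2) + ENNReal.ofReal (L ^ (-(2 - r)) * R) := by
        rw [ENNReal.ofReal_mul (by positivity)]
        gcongr
    _ ≤ ENNReal.ofReal (τ / 2) + ENNReal.ofReal (τ / 2) := by gcongr
    _ = _ := by rw [← ENNReal.ofReal_add (by positivity) (by positivity), add_halves]

/-- The image of `μ` under a simple function. -/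
def P2.map (f : SimpleFunc (Rd d) (Rd d)) (μ : P2 d) : P2 d :=
  ⟨μ.1.map f, by
    refine ⟨Measure.isProbabilityMeasure_map f.measurable.aemeasurable, ?_⟩
    obtain ⟨C, hC⟩ := f.exists_forall_norm_le
    rw [secondMoment, lintegral_map (by fun_prop) f.measurable]
    have hb : ∀ x, ‖f x‖ₑ ^ (2 : ℝ) ≤ ENNReal.ofReal C ^ (2 : ℝ) := fun x => by
      rw [← ofReal_norm]
      gcongr
      exact hC x
    refine (lintegral_mono hb).trans_lt ?_
    simp⟩

lemma P2.map_empirical {N : ℕ} [NeZero N] (f : SimpleFunc (Rd d) (Rd d)) (x : Fin N → Rd d) :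
    P2.map f (empirical x) = empirical fun i => f (x i) := by
  refine Subtype.ext ?_
  simp only [P2.map, empirical, Measure.map_smul, Measure.map_finset_sum f.measurable.aemeasurable,
    Measure.map_dirac' f.measurable]

lemma isCoupling_P2_map (f : SimpleFunc (Rd d) (Rd d)) (μ : P2 d) :
    IsCoupling μ.1 (P2.map f μ).1 (μ.1.map fun x => (x, f x)) := by
  have := isCoupling_map μ.1 measurable_id f.measurable
  rwa [Measure.map_id] at this

lemma cost_P2_map (r : ℝ) (f : SimpleFunc (Rd d) (Rd d)) (μ : P2 d) :
    cost r (μ.1.map fun x => (x, f x)) = ∫⁻ x, ‖x - f x‖ₑ ^ r ∂μ.1 := by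
  have := f.measurable
  rw [cost, lintegral_map (by fun_prop) (by fun_prop)]

/-- Two probability measures on the same finite set of points of diameter at most `D` have a
coupling with cost at most `D^r` times their total variation distance. -/
lemma exists_isCoupling_finite {ι : Type} [Fintype ι] {a b : ι → ℝ≥0∞} (ha : ∑ k, a k = 1)
    (hb : ∑ k, b k = 1) (c : ι → Rd d) {D : ℝ≥0∞} (hD : ∀ k l, ‖c k - c l‖ₑ ≤ D) {r : ℝ}
    (hr : 0 < r) : ∃ γ, IsCoupling (∑ k, a k • Measure.dirac (c k))
      (∑ k, b k • Measure.dirac (c k)) γ ∧ cost r γ ≤ D ^ r * ∑ k, (a k - b k) := by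
  set t := ∑ k, (a k - b k) with ht
  have hmin : ∀ k, min (a k) (b k) + (a k - b k) = a k := fun k => by
    rcases le_total (a k) (b k) with h | h
    · rw [min_eq_left h, tsub_eq_zero_of_le h, add_zero]
    · rw [min_eq_right h, add_tsub_cancel_of_le h]
  have hmin' : ∀ k, min (a k) (b k) + (b k - a k) = b k := fun k => by
    rcases le_total (a k) (b k) with h | h
    · rw [min_eq_left h, add_tsub_cancel_of_le h]
    · rw [min_eq_right h, tsub_eq_zero_of_le h, add_zero]
  have hsum : ∑ k, min (a k) (b k) + t = 1 := by
    rw [ht, ← Finset.sum_add_distrib]; simpa only [hmin] using ha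
  have hsum' : ∑ k, min (a k) (b k) + ∑ k, (b k - a k) = 1 := by
    rw [← Finset.sum_add_distrib]; simpa only [hmin'] using hb
  have hfin : ∑ k, min (a k) (b k) ≠ ∞ := ne_top_of_le_ne_top ENNReal.one_ne_top
    (hsum ▸ le_self_add)
  have htt : ∑ k, (b k - a k) = t :=
    (ENNReal.add_right_inj hfin).1 (hsum'.trans hsum.symm)
  have ht_top : t ≠ ∞ := ne_top_of_le_ne_top ENNReal.one_ne_top (hsum ▸ le_add_self)
  -- If `t = 0` then `t⁻¹ = ∞`, but `s = 0` as well and the product vanishes.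
  have hcancel : ∀ s, s ≤ t → t⁻¹ * (s * t) = s := fun s hs => by
    rcases eq_or_ne t 0 with h0 | h0
    · have : s = 0 := le_antisymm (h0 ▸ hs) zero_le
      simp [this]
    · rw [mul_comm s, ← mul_assoc, ENNReal.inv_mul_cancel h0 ht_top, one_mul]
  have hle : ∀ k, a k - b k ≤ t := fun k =>
    Finset.single_le_sum (f := fun k => a k - b k) (fun _ _ => zero_le) (Finset.mem_univ k)
  have hle' : ∀ k, b k - a k ≤ t := fun k => htt ▸
    Finset.single_le_sum (f := fun k => b k - a k) (fun _ _ => zero_le) (Finset.mem_univ k)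
  -- The common mass stays on the diagonal at no cost. The excess `a - b` is sent to the deficit `b
  -- - a` (truncated differences, both of total mass `t`) by their normalized product.
  refine ⟨∑ k, min (a k) (b k) • Measure.dirac (c k, c k) +
    t⁻¹ • ∑ k, ∑ l, ((a k - b k) * (b l - a l)) • Measure.dirac (c k, c l), ⟨?_, ?_⟩, ?_⟩
  · simp only [Measure.map_add _ _ measurable_fst, Measure.map_smul,
      Measure.map_finset_sum measurable_fst.aemeasurable, Measure.map_dirac' measurable_fst,
      ← Finset.sum_smul, ← Finset.mul_sum, htt, Finset.smul_sum, smul_smul, hcancel _ (hle _)]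
    simp only [← Finset.sum_add_distrib, ← add_smul, hmin]
  · have hcol : ∀ l, ∑ k, t⁻¹ * ((a k - b k) * (b l - a l)) = b l - a l := fun l => by
      rw [← Finset.mul_sum, ← Finset.sum_mul, ← ht, mul_comm t, hcancel _ (hle' l)]
    rw [Finset.sum_comm]
    simp only [Measure.map_add _ _ measurable_snd, Measure.map_smul,
      Measure.map_finset_sum measurable_snd.aemeasurable, Measure.map_dirac' measurable_snd,
      ← Finset.sum_smul, Finset.smul_sum, smul_smul, hcol]
    simp only [← Finset.sum_add_distrib, ← add_smul, hmin']
  · rw [cost, lintegral_add_measure, lintegral_finsetSum_measure, lintegral_smul_measure,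
      lintegral_finsetSum_measure]
    simp only [lintegral_finsetSum_measure, lintegral_smul_measure, lintegral_dirac, sub_self,
      enorm_zero, ENNReal.zero_rpow_of_pos hr, smul_eq_mul, mul_zero, Finset.sum_const_zero,
      zero_add]
    calc _ ≤ t⁻¹ * ∑ k, ∑ l, (a k - b k) * (b l - a l) * D ^ r := by
          gcongr with k _ l _
          exact hD k l
      _ = t⁻¹ * (t * t) * D ^ r := by
          simp only [← Finset.sum_mul, ← Finset.mul_sum, htt]
          rw [← ht]; ring
      _ = D ^ r * t := by rw [hcancel t le_rfl, mul_comm]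

lemma map_simpleFunc_eq_sum (f : SimpleFunc (Rd d) (Rd d)) (μ : Measure (Rd d)) :
    μ.map f = ∑ c : f.range, μ (f ⁻¹' {c.1}) • Measure.dirac c.1 := by
  have hg : Measurable fun x => (⟨f x, f.mem_range_self x⟩ : f.range) :=
    f.measurable.subtype_mk
  have h1 : μ.map f = (μ.map fun x => (⟨f x, f.mem_range_self x⟩ : f.range)).map Subtype.val := by
    rw [Measure.map_map measurable_subtype_coe hg]; rfl
  rw [h1, ← Measure.sum_smul_dirac (μ.map fun x => (⟨f x, f.mem_range_self x⟩ : f.range)),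
    Measure.sum_fintype, Measure.map_finset_sum measurable_subtype_coe.aemeasurable]
  simp only [Measure.map_smul, Measure.map_dirac' measurable_subtype_coe]
  refine Finset.sum_congr rfl fun c _ => ?_
  rw [Measure.map_apply hg (measurableSet_singleton c)]
  congr 2
  ext x
  simp [Subtype.ext_iff]

lemma sum_measure_preimage_range (f : SimpleFunc (Rd d) (Rd d)) (μ : Measure (Rd d))
    [IsProbabilityMeasure μ] : ∑ c : f.range, μ (f ⁻¹' {c.1}) = 1 := by
  have h := congrArg (fun ν : Measure (Rd d) => ν univ) (map_simpleFunc_eq_sum f μ)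
  simp only [Measure.map_apply f.measurable MeasurableSet.univ, preimage_univ, measure_univ,
    Measure.coe_finsetSum, Finset.sum_apply, Measure.smul_apply, smul_eq_mul, mul_one] at h
  exact h.symm

end Discretization

/-! ### Mean deviation of sample frequencies. -/

section Frequency

variable {α : Type} [MeasurableSpace α] {P : Measure α} [IsProbabilityMeasure P] {N : ℕ}
  {A : Set α}

lemma memLp_indicator_one (hA : MeasurableSet A) : MemLp (A.indicator (1 : α → ℝ)) 2 P :=
  MemLp.of_bound (measurable_one.indicator hA).aestronglyMeasurable 1
    (Eventually.of_forall fun a => by by_cases h : a ∈ A <;> simp [h])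

lemma memLp_frequency (hA : MeasurableSet A) :
    MemLp (fun x : Fin N → α => (N : ℝ)⁻¹ * ∑ i, A.indicator 1 (x i)) 2
      (Measure.pi fun _ : Fin N => P) := by
  have h : MemLp (fun x : Fin N → α => ∑ i, A.indicator (1 : α → ℝ) (x i)) 2
      (Measure.pi fun _ : Fin N => P) := memLp_finsetSum _ fun i _ =>
    (memLp_indicator_one hA).comp_measurePreserving (measurePreserving_eval (fun _ => P) i)
  exact h.const_mul _

variable [NeZero N]

lemma integral_frequency (hA : MeasurableSet A) :
    ∫ x, (N : ℝ)⁻¹ * ∑ i, A.indicator 1 (x i) ∂(Measure.pi fun _ : Fin N => P) = P.real A := by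
  have hN : (N : ℝ) ≠ 0 := by exact_mod_cast NeZero.ne N
  have h1 : ∀ i : Fin N, ∫ x, A.indicator (1 : α → ℝ) (x i) ∂(Measure.pi fun _ : Fin N => P) =
      P.real A := fun i => by
    rw [integral_comp_eval (μ := fun _ : Fin N => P) (memLp_indicator_one hA).aestronglyMeasurable,
      integral_indicator_one hA]
  rw [integral_const_mul, integral_finsetSum _ fun i _ => integrable_comp_eval
    (μ := fun _ : Fin N => P) ((memLp_indicator_one hA).integrable (by norm_num)),
    Finset.sum_congr rfl fun i _ => h1 i]
  simp [hN]

/-- Variances of independent coordinates add, and an indicator has variance at most `1`; the sharper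
`1/4` is not needed. -/
lemma variance_frequency_le (hA : MeasurableSet A) :
    ProbabilityTheory.variance (fun x : Fin N → α => (N : ℝ)⁻¹ * ∑ i, A.indicator 1 (x i))
      (Measure.pi fun _ : Fin N => P) ≤ (N : ℝ)⁻¹ := by
  have hN : (N : ℝ) ≠ 0 := by exact_mod_cast NeZero.ne N
  have h1 := ProbabilityTheory.variance_sum_pi (μ := fun _ : Fin N => P)
    (X := fun _ => A.indicator (1 : α → ℝ)) fun _ => memLp_indicator_one hA
  have h2 : ProbabilityTheory.variance (A.indicator (1 : α → ℝ)) P ≤ 1 := by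
    have := ProbabilityTheory.variance_le_sq_of_bounded (μ := P)
      (X := A.indicator (1 : α → ℝ)) (a := 0) (b := 1)
      (Eventually.of_forall fun a => by by_cases h : a ∈ A <;> simp [h])
      (measurable_one.indicator hA).aemeasurable
    exact this.trans (by norm_num)
  have h3 : (fun x : Fin N → α => (N : ℝ)⁻¹ * ∑ i, A.indicator 1 (x i)) = fun x =>
      (N : ℝ)⁻¹ * (∑ i, fun x : Fin N → α => A.indicator (1 : α → ℝ) (x i)) x := by
    ext x; simp
  rw [h3, ProbabilityTheory.variance_const_mul, h1]
  simp only [Finset.sum_const, Finset.card_univ, Fintype.card_fin, nsmul_eq_mul]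
  calc (N : ℝ)⁻¹ ^ 2 * (N * ProbabilityTheory.variance (A.indicator (1 : α → ℝ)) P)
      ≤ (N : ℝ)⁻¹ ^ 2 * (N * 1) := by gcongr
    _ = (N : ℝ)⁻¹ := by field_simp

/-- The truncated difference is the positive part of `Z` minus its mean; bound it by the absolute
value, then use Jensen with exponent `2`. -/
lemma lintegral_ofReal_sub_mean_le {Z : α → ℝ} (hZ : MemLp Z 2 P) (hZ0 : 0 ≤ ∫ a, Z a ∂P) :
    ∫⁻ a, (ENNReal.ofReal (Z a) - ENNReal.ofReal (∫ a, Z a ∂P)) ∂P ≤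
      ENNReal.ofReal (ProbabilityTheory.variance Z P) ^ (1 / 2 : ℝ) := by
  have hpt : ∀ a, ENNReal.ofReal (Z a) - ENNReal.ofReal (∫ a, Z a ∂P) ≤
      (‖Z a - ∫ a, Z a ∂P‖ₑ ^ (2 : ℝ)) ^ (1 / 2 : ℝ) := fun a => by
    rw [← ENNReal.rpow_mul, mul_one_div_cancel two_ne_zero, ENNReal.rpow_one,
      ← ENNReal.ofReal_sub _ hZ0, Real.enorm_eq_ofReal_abs]
    exact ENNReal.ofReal_le_ofReal (le_abs_self _)
  calc _ ≤ ∫⁻ a, (‖Z a - ∫ a, Z a ∂P‖ₑ ^ (2 : ℝ)) ^ (1 / 2 : ℝ) ∂P := lintegral_mono hpt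
    _ ≤ (∫⁻ a, ‖Z a - ∫ a, Z a ∂P‖ₑ ^ (2 : ℝ) ∂P) ^ (1 / 2 : ℝ) :=
        lintegral_rpow_inv_le one_le_two
          ((hZ.aestronglyMeasurable.sub aestronglyMeasurable_const).enorm.pow_const _)
    _ = _ := by
        rw [hZ.ofReal_variance_eq, ProbabilityTheory.evariance]
        simp only [ENNReal.rpow_ofNat]

/-- The frequency of a set in a sample exceeds its probability by at most `1/√N` on average. -/
lemma lintegral_frequency_sub_le (hA : MeasurableSet A) :
    ∫⁻ x, ((N : ℝ≥0∞)⁻¹ * ∑ i, A.indicator 1 (x i) - P A) ∂(Measure.pi fun _ : Fin N => P) ≤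
      ((N : ℝ≥0∞)⁻¹) ^ (1 / 2 : ℝ) := by
  have hN : (0 : ℝ) < N := by exact_mod_cast Nat.pos_of_ne_zero (NeZero.ne N)
  have hmean := integral_frequency (P := P) (N := N) hA
  have hvar := variance_frequency_le (P := P) (N := N) hA
  have hZ2 := memLp_frequency (P := P) (N := N) hA
  have e1 : ∀ x : Fin N → α, (N : ℝ≥0∞)⁻¹ * ∑ i, A.indicator 1 (x i) =
      ENNReal.ofReal ((N : ℝ)⁻¹ * ∑ i, A.indicator 1 (x i)) := fun x => by
    rw [ENNReal.ofReal_mul (by positivity), ENNReal.ofReal_inv_of_pos hN, ENNReal.ofReal_natCast,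
      ENNReal.ofReal_sum_of_nonneg fun i _ => Set.indicator_nonneg (by simp) _]
    congr 2 with i
    by_cases h : x i ∈ A <;> simp [h]
  have e2 : P A = ENNReal.ofReal (P.real A) := (ofReal_measureReal).symm
  simp only [e1, e2]
  rw [← hmean]
  refine (lintegral_ofReal_sub_mean_le hZ2 (hmean ▸ measureReal_nonneg)).trans ?_
  gcongr
  rw [← ENNReal.ofReal_natCast, ← ENNReal.ofReal_inv_of_pos hN]
  exact ENNReal.ofReal_le_ofReal hvar

end Frequency

/-! ### Law of large numbers for `φ` at empirical measures, and uniform convergence. -/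

section Convergence

variable {d N : ℕ} [NeZero N] {r C ε : ℝ} {φ : Rd d → P2 d → ℝ}

lemma empirical_apply {A : Set (Rd d)} (hA : MeasurableSet A) (x : Fin N → Rd d) :
    (empirical x).1 A = (N : ℝ≥0∞)⁻¹ * ∑ i, A.indicator 1 (x i) := by
  simp [empirical, Measure.dirac_apply' _ hA]

lemma IsLipschitzWith.enorm_sub_le_rpow (hr : 1 ≤ r) (hC : 0 ≤ C) (h : IsLipschitzWith r C φ)
    (x : Rd d) {μ ν : P2 d} {γ : Measure (Rd d × Rd d)} (hγ : IsCoupling μ.1 ν.1 γ) {c : ℝ≥0∞}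
    (hc : cost r γ ≤ c) : ‖φ x μ - φ x ν‖ₑ ≤ ENNReal.ofReal C * c ^ (1 / r) := by
  refine (h.enorm_sub_le hC x x hγ).trans ?_
  rw [sub_self, enorm_zero, zero_add]
  gcongr

/-- The error of an empirical measure, split by the discretization `f`. -/
lemma IsLipschitzWith.enorm_empirical_sub_le (hr : 1 ≤ r) (hC : 0 ≤ C)
    (h : IsLipschitzWith r C φ) (f : SimpleFunc (Rd d) (Rd d)) {D : ℝ≥0∞}
    (hD : ∀ y z, ‖f y - f z‖ₑ ≤ D) (x : Rd d) (μ : P2 d) (X : Fin N → Rd d) :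
    ‖φ x (empirical X) - φ x μ‖ₑ ≤
      ENNReal.ofReal C * ((N : ℝ≥0∞)⁻¹ * ∑ i, ‖X i - f (X i)‖ₑ ^ r) ^ (1 / r) +
      ENNReal.ofReal C * (D ^ r * ∑ c : f.range, ((N : ℝ≥0∞)⁻¹ *
        ∑ i, (f ⁻¹' {c.1}).indicator 1 (X i) - μ.1 (f ⁻¹' {c.1}))) ^ (1 / r) +
      ENNReal.ofReal C * (∫⁻ y, ‖y - f y‖ₑ ^ r ∂μ.1) ^ (1 / r) := by
  have h1 : ‖φ x (empirical X) - φ x (P2.map f (empirical X))‖ₑ ≤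
      ENNReal.ofReal C * ((N : ℝ≥0∞)⁻¹ * ∑ i, ‖X i - f (X i)‖ₑ ^ r) ^ (1 / r) := by
    rw [P2.map_empirical]
    refine h.enorm_sub_le_rpow hr hC x (isCoupling_empirical X fun i => f (X i)) ?_
    rw [cost_empirical]
  have h2 : ‖φ x (P2.map f (empirical X)) - φ x (P2.map f μ)‖ₑ ≤
      ENNReal.ofReal C * (D ^ r * ∑ c : f.range, ((N : ℝ≥0∞)⁻¹ *
        ∑ i, (f ⁻¹' {c.1}).indicator 1 (X i) - μ.1 (f ⁻¹' {c.1}))) ^ (1 / r) := by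
    obtain ⟨γ, hγ, hcost⟩ := exists_isCoupling_finite (sum_measure_preimage_range f (empirical X).1)
      (sum_measure_preimage_range f μ.1) (fun c : f.range => c.1) (D := D) (fun c c' => by
        obtain ⟨y, hy⟩ := SimpleFunc.mem_range.1 c.2
        obtain ⟨z, hz⟩ := SimpleFunc.mem_range.1 c'.2
        rw [← hy, ← hz]
        exact hD y z) (r := r) (by linarith)
    rw [← map_simpleFunc_eq_sum, ← map_simpleFunc_eq_sum] at hγ
    refine h.enorm_sub_le_rpow hr hC x (μ := P2.map f (empirical X)) (ν := P2.map f μ) hγ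
      (hcost.trans_eq ?_)
    simp only [empirical_apply (f.measurableSet_fiber _)]
  have h3 : ‖φ x (P2.map f μ) - φ x μ‖ₑ ≤
      ENNReal.ofReal C * (∫⁻ y, ‖y - f y‖ₑ ^ r ∂μ.1) ^ (1 / r) := by
    rw [← enorm_neg, neg_sub]
    exact h.enorm_sub_le_rpow hr hC x (isCoupling_P2_map f μ) (cost_P2_map r f μ).le
  -- Discretize both measures by the same `f`; only the middle term, between measures on `f.range`,
  -- sees the sampling error.
  have hsplit : φ x (empirical X) - φ x μ = (φ x (empirical X) - φ x (P2.map f (empirical X))) +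
      (φ x (P2.map f (empirical X)) - φ x (P2.map f μ)) + (φ x (P2.map f μ) - φ x μ) := by ring
  rw [hsplit]
  exact (enorm_add_le _ _).trans (add_le_add ((enorm_add_le _ _).trans (add_le_add h1 h2)) h3)

/-- The mean error of empirical measures, uniformly in terms of the discretization error. -/
lemma IsLipschitzWith.lintegral_empirical_sub_le (hr : 1 ≤ r) (hC : 0 ≤ C)
    (h : IsLipschitzWith r C φ) (f : SimpleFunc (Rd d) (Rd d)) {D : ℝ≥0∞}
    (hD : ∀ y z, ‖f y - f z‖ₑ ≤ D) (x : Rd d) (μ : P2 d) :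
    ∫⁻ X, ‖φ x (empirical X) - φ x μ‖ₑ ∂(Measure.pi fun _ : Fin N => μ.1) ≤
      ENNReal.ofReal C * (∫⁻ y, ‖y - f y‖ₑ ^ r ∂μ.1) ^ (1 / r) +
      ENNReal.ofReal C *
        (D ^ r * (f.range.card * ((N : ℝ≥0∞)⁻¹) ^ (1 / 2 : ℝ))) ^ (1 / r) +
      ENNReal.ofReal C * (∫⁻ y, ‖y - f y‖ₑ ^ r ∂μ.1) ^ (1 / r) := by
  have hf := f.measurable
  have hm1 : Measurable fun X : Fin N → Rd d =>
      (N : ℝ≥0∞)⁻¹ * ∑ i, ‖X i - f (X i)‖ₑ ^ r := by fun_prop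
  have hind : ∀ c : f.range, Measurable fun X : Fin N → Rd d => (N : ℝ≥0∞)⁻¹ *
      ∑ i, (f ⁻¹' {c.1}).indicator (1 : Rd d → ℝ≥0∞) (X i) - μ.1 (f ⁻¹' {c.1}) := fun c => by
    have : Measurable ((f ⁻¹' {c.1}).indicator (1 : Rd d → ℝ≥0∞)) :=
      measurable_one.indicator (f.measurableSet_fiber _)
    fun_prop
  have hm2 : Measurable fun X : Fin N → Rd d => D ^ r * ∑ c : f.range, ((N : ℝ≥0∞)⁻¹ *
      ∑ i, (f ⁻¹' {c.1}).indicator (1 : Rd d → ℝ≥0∞) (X i) - μ.1 (f ⁻¹' {c.1})) :=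
    (Finset.measurable_sum _ fun c _ => hind c).const_mul _
  refine (lintegral_mono fun X => h.enorm_empirical_sub_le hr hC f hD x μ X).trans ?_
  rw [lintegral_add_right _ measurable_const, lintegral_add_left ((hm1.pow_const _).const_mul _),
    lintegral_const_mul _ (hm1.pow_const _), lintegral_const_mul _ (hm2.pow_const _),
    lintegral_const, measure_univ, mul_one]
  refine add_le_add (add_le_add ?_ ?_) le_rfl
  -- The mean discretization error of the sample equals that of `μ`, so the first and third terms
  -- end up with the same bound.
  · gcongr
    refine (lintegral_rpow_inv_le hr hm1.aemeasurable).trans_eq ?_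
    rw [lintegral_const_mul _ (by fun_prop), lintegral_finsetSum _ (fun i _ => by fun_prop)]
    have hi : ∀ i : Fin N, ∫⁻ X, ‖X i - f (X i)‖ₑ ^ r ∂(Measure.pi fun _ : Fin N => μ.1) =
        ∫⁻ y, ‖y - f y‖ₑ ^ r ∂μ.1 := fun i =>
      lintegral_pi_eval (f := fun y : Rd d => ‖y - f y‖ₑ ^ r) (by fun_prop) i
    simp only [hi]
    rw [inv_mul_sum_const]
  · gcongr
    refine (lintegral_rpow_inv_le hr hm2.aemeasurable).trans ?_
    gcongr
    rw [lintegral_const_mul _ (Finset.measurable_sum _ fun c _ => hind c)]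
    gcongr
    rw [lintegral_finsetSum _ fun c _ => hind c]
    refine (Finset.sum_le_sum fun c _ =>
      lintegral_frequency_sub_le (P := μ.1) (N := N) (f.measurableSet_fiber c.1)).trans_eq ?_
    simp

/-- The mollifier lives on the sup-norm ball of radius `ε`, and `onPoints` is `2C`-Lipschitz for the
sup norm. -/
lemma IsLipschitzWith.enorm_mollifyAll_sub_onPoints_le (hr : 1 ≤ r) (hC : 0 ≤ C) (hε : 0 < ε)
    (h : IsLipschitzWith r C φ) (z : Fin (N + 1) → Rd d) :
    ‖mollifyAll φ N ε z - onPoints φ N z‖ₑ ≤ ENNReal.ofReal (2 * C * ε) := by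
  have hL := h.lipschitzWith_onPoints (N := N) hr hC
  have hint := (integrable_prodMollifier (d := d) (N := N + 1) hε).mul_const (onPoints φ N z)
  have h1 : onPoints φ N z =
      ∫ y : Fin (N + 1) → Rd d, prodMollifier ε y * onPoints φ N z := by
    rw [integral_mul_const, integral_prodMollifier hε, one_mul]
  have h2 : mollifyAll φ N ε z - onPoints φ N z =
      ∫ y, prodMollifier ε y * (onPoints φ N (z - y) - onPoints φ N z) := by
    conv_lhs => rw [h1]
    rw [mollifyAll, ← integral_sub (h.integrable_mollifyAll_integrand hr hC hε z) hint]
    simp only [mul_sub]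
  rw [h2]
  refine (enorm_integral_le_lintegral_enorm _).trans ?_
  calc _ ≤ ∫⁻ y : Fin (N + 1) → Rd d,
        ENNReal.ofReal (prodMollifier ε y) * ENNReal.ofReal (2 * C * ε) := by
        refine lintegral_mono fun y => ?_
        by_cases hy : ∃ i, ε ≤ ‖y i‖
        · obtain ⟨i, hi⟩ := hy
          simp [prodMollifier_eq_zero hε hi]
        · rw [enorm_mul, Real.enorm_of_nonneg (prodMollifier_nonneg hε y)]
          gcongr
          rw [Real.enorm_eq_ofReal_abs]
          refine ENNReal.ofReal_le_ofReal ?_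
          push Not at hy
          have hyn : ‖y‖ ≤ ε := (pi_norm_le_iff_of_nonneg hε.le).2 fun i => (hy i).le
          have := hL.dist_le_mul (z - y) z
          rw [Real.dist_eq, dist_eq_norm, sub_sub_cancel_left, norm_neg] at this
          refine this.trans ?_
          simp only [NNReal.coe_mul, NNReal.coe_ofNat, Real.coe_toNNReal _ hC]
          gcongr
    _ = _ := by
        rw [lintegral_mul_const _ (contDiff_prodMollifier ε).continuous.measurable.ennreal_ofReal,
          lintegral_prodMollifier hε, one_mul]

lemma IsLipschitzWith.enorm_approx_sub_le (hr : 1 ≤ r) (hC : 0 ≤ C) (hε : 0 < ε)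
    (h : IsLipschitzWith r C φ) (f : SimpleFunc (Rd d) (Rd d)) {D : ℝ≥0∞}
    (hD : ∀ y z, ‖f y - f z‖ₑ ≤ D) (x : Rd d) (μ : P2 d) :
    ‖WassersteinApprox.approx φ N ε x μ - φ x μ‖ₑ ≤ ENNReal.ofReal (2 * C * ε) +
      (ENNReal.ofReal C * (∫⁻ y, ‖y - f y‖ₑ ^ r ∂μ.1) ^ (1 / r) +
      ENNReal.ofReal C *
        (D ^ r * (f.range.card * ((N : ℝ≥0∞)⁻¹) ^ (1 / 2 : ℝ))) ^ (1 / r) +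
      ENNReal.ofReal C * (∫⁻ y, ‖y - f y‖ₑ ^ r ∂μ.1) ^ (1 / r)) := by
  obtain ⟨K, hK⟩ :=
    ((h.boundedDerivs_mollifyAll (N := N) hr hC hε).comp_clm (consMap d N)).exists_lipschitzWith
  have h1 : WassersteinApprox.approx φ N ε x μ - φ x μ =
      ∫ X, (mollifyAll φ N ε (consMap d N (x, X)) - φ x μ) ∂(Measure.pi fun _ : Fin N => μ.1) := by
    rw [integral_sub (integrable_pi_of_lipschitzWith hK x μ) (integrable_const _),
      approx_eq_average]
    simp [average]
  rw [h1]
  refine (enorm_integral_le_lintegral_enorm _).trans ?_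
  calc _ ≤ ∫⁻ X, (ENNReal.ofReal (2 * C * ε) + ‖φ x (empirical X) - φ x μ‖ₑ)
        ∂(Measure.pi fun _ : Fin N => μ.1) := by
        refine lintegral_mono fun X => ?_
        have h2 := h.enorm_mollifyAll_sub_onPoints_le hr hC hε (consMap d N (x, X))
        have h3 : onPoints φ N (consMap d N (x, X)) = φ x (empirical X) := by
          simp [onPoints, consMap_apply]
        rw [h3] at h2
        refine le_trans ?_ (add_le_add h2 le_rfl)
        refine le_trans (le_of_eq ?_) (enorm_add_le _ _)
        rw [sub_add_sub_cancel]
    _ ≤ _ := by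
        rw [lintegral_add_left measurable_const, lintegral_const, measure_univ, mul_one]
        gcongr
        exact h.lintegral_empirical_sub_le hr hC f hD x μ

end Convergence

lemma IsLipschitzWith.tendstoUniformlyOn_approx {d : ℕ} {r C : ℝ} {φ : Rd d → P2 d → ℝ}
    (hr : 1 ≤ r) (hr₂ : r < 2) (hC : 0 ≤ C) (h : IsLipschitzWith r C φ) (R : ℝ) :
    TendstoUniformlyOn (fun (k : ℕ) (p : Rd d × P2 d) =>
        WassersteinApprox.approx φ (k + 1) (1 / ((k : ℝ) + 1)) p.1 p.2)
      (fun p => φ p.1 p.2) atTop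
      (univ ×ˢ {μ | secondMoment μ.1 ≤ ENNReal.ofReal R}) := by
  rw [Metric.tendstoUniformlyOn_iff]
  intro η hη
  have hr0 : 0 < r := by linarith
  -- The two discretization terms then total `2Cs ≤ η/2`; the `+ 1` covers `C = 0`.
  set s : ℝ := η / (4 * (C + 1)) with hs
  have hs0 : 0 < s := by positivity
  obtain ⟨f, hf⟩ := exists_simpleFunc_cost_le d hr hr₂ (R := R) (Real.rpow_pos_of_pos hs0 r)
  obtain ⟨M, hM⟩ := f.exists_forall_norm_le
  have hD : ∀ y z, ‖f y - f z‖ₑ ≤ ENNReal.ofReal (2 * M) := fun y z => by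
    rw [← ofReal_norm]
    refine ENNReal.ofReal_le_ofReal ((norm_sub_le _ _).trans ?_)
    linarith [hM y, hM z]
  -- Since `f` is fixed before `k`, its diameter bound and the size of its range are constants; the
  -- remaining terms depend on neither `x` nor `μ`.
  have hlim : Tendsto (fun k : ℕ => ENNReal.ofReal (2 * C * (1 / ((k : ℝ) + 1))) +
      ENNReal.ofReal C * (ENNReal.ofReal (2 * M) ^ r *
        (f.range.card * (((k + 1 : ℕ) : ℝ≥0∞)⁻¹) ^ (1 / 2 : ℝ))) ^ (1 / r)) atTop (𝓝 0) := by
    have h1 : Tendsto (fun k : ℕ => ENNReal.ofReal (2 * C * (1 / ((k : ℝ) + 1)))) atTop (𝓝 0) := by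
      have := (tendsto_one_div_add_atTop_nhds_zero_nat (𝕜 := ℝ)).const_mul (2 * C)
      rw [mul_zero] at this
      simpa using ENNReal.tendsto_ofReal this
    have h2 : Tendsto (fun k : ℕ => (((k + 1 : ℕ) : ℝ≥0∞)⁻¹) ^ (1 / 2 : ℝ)) atTop (𝓝 0) := by
      have := (ENNReal.tendsto_inv_nat_nhds_zero.comp (tendsto_add_atTop_nat 1)).ennrpow_const
        (1 / 2 : ℝ)
      rwa [ENNReal.zero_rpow_of_pos (by norm_num)] at this
    have h3 := ENNReal.Tendsto.const_mul (a := (f.range.card : ℝ≥0∞)) h2 (Or.inr (by simp))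
    have h4 := ENNReal.Tendsto.const_mul (a := ENNReal.ofReal (2 * M) ^ r) h3
      (Or.inr (by finiteness))
    have h5 := h4.ennrpow_const (1 / r)
    have h6 := ENNReal.Tendsto.const_mul (a := ENNReal.ofReal C) h5 (Or.inr (by simp))
    have hr' : 0 < 1 / r := by positivity
    rw [mul_zero, mul_zero, ENNReal.zero_rpow_of_pos hr', mul_zero] at h6
    simpa using h1.add h6
  have hη2 : 0 < ENNReal.ofReal (η / 2) := by simpa using hη
  filter_upwards [hlim.eventually_lt_const hη2] with k hk
  rintro ⟨x, μ⟩ ⟨-, hμ⟩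
  have hcost : (∫⁻ y, ‖y - f y‖ₑ ^ r ∂μ.1) ^ (1 / r) ≤ ENNReal.ofReal s := by
    rw [one_div, ENNReal.rpow_inv_le_iff hr0, ENNReal.ofReal_rpow_of_pos hs0]
    exact hf μ hμ
  have hk0 : 0 < 1 / ((k : ℝ) + 1) := by positivity
  have hb := h.enorm_approx_sub_le (N := k + 1) hr hC hk0 f hD x μ
  have hCs : C * s + C * s ≤ η / 2 := by
    have : C * s ≤ η / 4 := by
      rw [hs, mul_div_assoc', div_le_iff₀ (by positivity)]
      nlinarith
    linarith
  have hlt : ‖WassersteinApprox.approx φ (k + 1) (1 / ((k : ℝ) + 1)) x μ - φ x μ‖ₑ <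
      ENNReal.ofReal η := by
    calc _ ≤ _ := hb
      _ ≤ ENNReal.ofReal (2 * C * (1 / ((k : ℝ) + 1))) + (ENNReal.ofReal C * ENNReal.ofReal s +
            ENNReal.ofReal C * (ENNReal.ofReal (2 * M) ^ r *
              (f.range.card * (((k + 1 : ℕ) : ℝ≥0∞)⁻¹) ^ (1 / 2 : ℝ))) ^ (1 / r) +
            ENNReal.ofReal C * ENNReal.ofReal s) := by gcongr
      _ = (ENNReal.ofReal (2 * C * (1 / ((k : ℝ) + 1))) +
            ENNReal.ofReal C * (ENNReal.ofReal (2 * M) ^ r *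
              (f.range.card * (((k + 1 : ℕ) : ℝ≥0∞)⁻¹) ^ (1 / 2 : ℝ))) ^ (1 / r)) +
            ENNReal.ofReal (C * s + C * s) := by
          rw [ENNReal.ofReal_add (by positivity) (by positivity), ENNReal.ofReal_mul hC]
          ring
      _ < ENNReal.ofReal (η / 2) + ENNReal.ofReal (η / 2) :=
          ENNReal.add_lt_add_of_lt_of_le ENNReal.ofReal_ne_top hk (ENNReal.ofReal_le_ofReal hCs)
      _ = ENNReal.ofReal η := by
          rw [← ENNReal.ofReal_add (by positivity) (by positivity), add_halves]
  rw [Real.enorm_eq_ofReal_abs, ENNReal.ofReal_lt_ofReal_iff hη] at hlt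
  rwa [dist_comm, Real.dist_eq]

end

end WassersteinApprox

theorem theorem6p1 (d : ℕ) (r : ℝ) (hr₁ : 1 ≤ r) (hr₂ : r < 2)
    (φ : WassersteinApprox.Rd d → WassersteinApprox.P2 d → ℝ)
    (hφ : ∃ C : ℝ, WassersteinApprox.IsLipschitzWith r C φ) :
    ∃ φk : ℕ → WassersteinApprox.Rd d → WassersteinApprox.P2 d → ℝ,
      (∀ k, φk k = WassersteinApprox.approx φ (k + 1) (1 / ((k : ℝ) + 1))) ∧
      (∀ k, WassersteinApprox.IsSmooth (φk k)) ∧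
      (∃ C : ℝ, ∀ k, WassersteinApprox.IsLipschitzWith r C (φk k)) ∧
      (∀ R : ℝ, 0 < R →
        TendstoUniformlyOn (fun k (p : WassersteinApprox.Rd d × WassersteinApprox.P2 d) =>
            φk k p.1 p.2)
          (fun p => φ p.1 p.2) atTop
          (Metric.ball 0 R ×ˢ {μ | WassersteinApprox.secondMoment μ.1 ≤ ENNReal.ofReal R})) ∧
      (∀ k, WassersteinApprox.IsC11 (WassersteinApprox.lift (φk k))) ∧
      (ConvexOn ℝ univ (WassersteinApprox.lift φ) →
        ∀ k, ConvexOn ℝ univ (WassersteinApprox.lift (φk k))) := by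
  obtain ⟨C₀, hC₀⟩ := hφ
  have hC : 0 ≤ |C₀| := abs_nonneg C₀
  -- The given constant carries no sign condition; its absolute value also works.
  have h : WassersteinApprox.IsLipschitzWith r |C₀| φ := hC₀.mono (le_abs_self C₀)
  have hε : ∀ k : ℕ, 0 < 1 / ((k : ℝ) + 1) := fun k => by positivity
  -- Indices start at `0`, so the entry `k` uses `k + 1` samples and radius `1/(k + 1)`.
  refine ⟨fun k => WassersteinApprox.approx φ (k + 1) (1 / ((k : ℝ) + 1)), fun _ => rfl,
    fun k => h.isSmooth_approx hr₁ hC (hε k), ⟨|C₀|, fun k => h.approx hr₁ hr₂.le hC (hε k)⟩,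
    fun R _ => (h.tendstoUniformlyOn_approx hr₁ hr₂ hC R).mono
      (Set.prod_mono_left (Set.subset_univ _)),
    fun k => h.isC11_lift_approx hr₁ hC (hε k),
    fun hconv k => WassersteinApprox.convexOn_lift_approx hr₁ hC (hε k) h hconv⟩
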